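/- Let $G=(V,E)$ be a finite simple graph and let $D=(E,A)$ be a digraph whose vertices are the edges of $G$. For $e\in E$ let $\mathrm{dep}(e)=\{e'\in E:(e',e)\in A\}$, and for $X\subseteq E$ let $\mathrm{dep}(X)=\bigcup_{e\in X}\mathrm{dep}(e)$. For functions $\ell,u:E\to\mathbb N$, the problem G-DCST$(G,D,\ell,u)$ asks whether $G$ has a spanning tree $T$ with $\ell(e)\le|\mathrm{dep}(e)\cap E(T)|\le u(e)$ for every $e\in E(T)$; it is called feasible if such a $T$ exists. Theorem. Consider the instances in which every weakly connected component of $D$ is a directed path of length at most $1$ (a single vertex, or two vertices joined by exactly one arc) and $\ell(e)=u(e)=|\mathrm{dep}(e)|\in\{0,1\}$ for every $e\in E$. (1) On these instances, G-DCST can be solved in polynomial time: there is a program for a unit-cost random access machine (with addition and truncated subtraction, but no multiplication) which, given lists of the edges of $G$ by their ends and of the arcs of $D$, decides G-DCST$(G,D,\ell,u)$ in a number of steps bounded by a polynomial in $|V|+|E|+|A|$. (2) For each such instance let $S=\{e\in E:\mathrm{dep}(e)\neq\emptyset\}$, let $k$ be the number of connected components of $G-S=(V,E\setminus S)$, and let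 $H$ be the multigraph obtained from $G$ by contracting each connected component of $G-S$ to a single vertex, where an edge of $S$ with both ends in the same component becomes a loop. Then the sets $X\subseteq S$ such that $(V,\mathrm{dep}(X))$ is acyclic are the independent sets of a graphic matroid $M_1$ on $S$ (that of the graph $(V,\mathrm{dep}(S))$, with $e\in S$ identified with the unique member of $\mathrm{dep}(e)$); the sets $X\subseteq S$ that contain no cycle of $H$ (loops count as cycles) are the independent sets of a graphic matroid $M_2$ on $S$; and G-DCST$(G,D,\ell,u)$ is feasible if and only if there is a set of size $k-1$ that is independent in both $M_1$ and $M_2$. -/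

import Mathlib

namespace DCST

/-! ### Polynomial time: programs on a random access machine with unit cost -/

/-- The store of a random access machine: registers and arrays, all holding natural numbers. -/
structure Store where
  reg : ℕ → ℕ
  arr : ℕ → ℕ → ℕ

/-- `x := v`. -/
def Store.setReg (s : Store) (x v : ℕ) : Store where
  reg := Function.update s.reg x v
  arr := s.arr

/-- `a[i] := v`. -/
def Store.setArr (s : Store) (a i v : ℕ) : Store where
  reg := s.reg
  arr := Function.update s.arr a (Function.update (s.arr a) i v)

/-- Programs. A program names finitely many registers and arrays. The only arithmetic operations
are addition and truncated subtraction (no multiplication), so that `t` steps produce numbers of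
`O(t)` more bits than the input has: unit cost is polynomially equivalent to Turing machine
time. -/
inductive Prog where
  /-- do nothing -/
  | skip
  /-- `reg x := c` -/
  | const (x c : ℕ)
  /-- `reg x := reg y + reg z` -/
  | add (x y z : ℕ)
  /-- `reg x := reg y - reg z` (truncated at zero) -/
  | sub (x y z : ℕ)
  /-- `reg x := arr a [reg y]` -/
  | load (x a y : ℕ)
  /-- `arr a [reg x] := reg y` -/
  | store (a x y : ℕ)
  /-- `p; q` -/
  | seq (p q : Prog)
  /-- `if reg x < reg y then p else q` -/
  | ite (x y : ℕ) (p q : Prog)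
  /-- `while reg x < reg y do p` -/
  | loop (x y : ℕ) (p : Prog)

/-- `Exec p s s' t`: the program `p`, started in the store `s`, halts in the store `s'` after
exactly `t` steps. Each elementary instruction and each evaluation of a test is one step. -/
inductive Exec : Prog → Store → Store → ℕ → Prop where
  | skip (s : Store) : Exec .skip s s 1
  | const (s : Store) (x c : ℕ) : Exec (.const x c) s (s.setReg x c) 1
  | add (s : Store) (x y z : ℕ) : Exec (.add x y z) s (s.setReg x (s.reg y + s.reg z)) 1
  | sub (s : Store) (x y z : ℕ) : Exec (.sub x y z) s (s.setReg x (s.reg y - s.reg z)) 1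
  | load (s : Store) (x a y : ℕ) : Exec (.load x a y) s (s.setReg x (s.arr a (s.reg y))) 1
  | store (s : Store) (a x y : ℕ) : Exec (.store a x y) s (s.setArr a (s.reg x) (s.reg y)) 1
  | seq {p q : Prog} {s s' s'' : Store} {t t' : ℕ} :
      Exec p s s' t → Exec q s' s'' t' → Exec (.seq p q) s s'' (t + t')
  | iteTrue {x y : ℕ} {p q : Prog} {s s' : Store} {t : ℕ} :
      s.reg x < s.reg y → Exec p s s' t → Exec (.ite x y p q) s s' (t + 1)
  | iteFalse {x y : ℕ} {p q : Prog} {s s' : Store} {t : ℕ} :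
      ¬ s.reg x < s.reg y → Exec q s s' t → Exec (.ite x y p q) s s' (t + 1)
  | loopDone {x y : ℕ} {p : Prog} {s : Store} :
      ¬ s.reg x < s.reg y → Exec (.loop x y p) s s 1
  | loopStep {x y : ℕ} {p : Prog} {s s' s'' : Store} {t t' : ℕ} :
      s.reg x < s.reg y → Exec p s s' t → Exec (.loop x y p) s' s'' t' →
        Exec (.loop x y p) s s'' (t + t' + 1)

/-- Execution is deterministic: both the final store and the number of steps are determined by
the program and the initial store. -/
theorem Exec.deterministic {p : Prog} {s s₁ s₂ : Store} {t₁ t₂ : ℕ}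
    (h₁ : Exec p s s₁ t₁) (h₂ : Exec p s s₂ t₂) : s₁ = s₂ ∧ t₁ = t₂ := by
  induction h₁ generalizing s₂ t₂ with
  | seq _ _ ih ih' =>
    cases h₂ with
    | seq a b =>
      obtain ⟨rfl, rfl⟩ := ih a
      obtain ⟨rfl, rfl⟩ := ih' b
      exact ⟨rfl, rfl⟩
  | iteTrue h _ ih =>
    cases h₂ with
    | iteTrue _ a => obtain ⟨rfl, rfl⟩ := ih a; exact ⟨rfl, rfl⟩
    | iteFalse h' _ => exact absurd h h'
  | iteFalse h _ ih =>
    cases h₂ with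
    | iteTrue h' _ => exact absurd h' h
    | iteFalse _ a => obtain ⟨rfl, rfl⟩ := ih a; exact ⟨rfl, rfl⟩
  | loopDone h =>
    cases h₂ with
    | loopDone _ => exact ⟨rfl, rfl⟩
    | loopStep h' _ _ => exact absurd h' h
  | loopStep h _ _ ih ih' =>
    cases h₂ with
    | loopDone h' => exact absurd h h'
    | loopStep _ a b =>
      obtain ⟨rfl, rfl⟩ := ih a
      obtain ⟨rfl, rfl⟩ := ih' b
      exact ⟨rfl, rfl⟩
  | _ => cases h₂; exact ⟨rfl, rfl⟩

/-- A decision problem, with instances `i : ι` of size `size i` that are presented to the machine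
as the initial store `input i`, is solvable in polynomial time: one program halts on every
instance after a number of steps polynomial in the size, and ends with a nonzero number in
register `0` exactly on the yes-instances. -/
def SolvableInPolyTime {ι : Type} (input : ι → Store) (size : ι → ℕ) (yes : ι → Prop) : Prop :=
  ∃ (P : Prog) (b : Polynomial ℕ), ∀ i : ι, ∃ (s : Store) (t : ℕ),
    Exec P (input i) s t ∧ t ≤ b.eval (size i) ∧ (s.reg 0 ≠ 0 ↔ yes i)

/-! ### Dependency constrained spanning trees -/

section Problem

variable {V : Type*} {G : SimpleGraph V}

/-- The dependencies of an edge: its in-neighbours in `D`. -/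
def dep (D : Digraph G.edgeSet) (e : G.edgeSet) : Set G.edgeSet :=
  {e' | D.Adj e' e}

/-- The union of the dependency sets of the members of a set of edges. -/
def depSet (D : Digraph G.edgeSet) (X : Set G.edgeSet) : Set G.edgeSet :=
  ⋃ e ∈ X, dep D e

/-- `T` `(ℓ, u)`-satisfies `D`. -/
def Satisfies (D : Digraph G.edgeSet) (ℓ u : G.edgeSet → ℕ) (T : SimpleGraph V) : Prop :=
  ∀ e : G.edgeSet, (e : Sym2 V) ∈ T.edgeSet →
    ℓ e ≤ (dep D e ∩ {e' | (e' : Sym2 V) ∈ T.edgeSet}).ncard ∧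
      (dep D e ∩ {e' | (e' : Sym2 V) ∈ T.edgeSet}).ncard ≤ u e

/-- The problem G-DCST: is there a spanning tree of `G` that `(ℓ, u)`-satisfies `D`? -/
def GDCST (D : Digraph G.edgeSet) (ℓ u : G.edgeSet → ℕ) : Prop :=
  ∃ T : SimpleGraph V, T ≤ G ∧ T.IsTree ∧ Satisfies D ℓ u T

/-- Every (weakly) connected component of `D` is a directed path of length at most one: a single
vertex without a loop, or two vertices joined by exactly one arc. -/
def ComponentsArePathsOfLengthLEOne {E : Type*} (D : Digraph E) : Prop :=
  ∀ c : D.toSimpleGraphInclusive.ConnectedComponent,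
    (∃ e, c.supp = {e} ∧ ¬ D.Adj e e) ∨
      ∃ e f, e ≠ f ∧ c.supp = {e, f} ∧
        ∀ a ∈ c.supp, ∀ b ∈ c.supp, (D.Adj a b ↔ a = e ∧ b = f)

/-- The set `S` of the edges that have a dependency. -/
def dependentEdges (D : Digraph G.edgeSet) : Set G.edgeSet :=
  {e | (dep D e).Nonempty}

/-- The graph `G - S`. -/
def baseGraph (D : Digraph G.edgeSet) : SimpleGraph V :=
  G.deleteEdges (Subtype.val '' dependentEdges D)

/-- The ends of an edge in the multigraph `H` that is obtained from `G` by contracting each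
connected component of `G - S` to a vertex. -/
def contractedEnds (D : Digraph G.edgeSet) (e : G.edgeSet) :
    Sym2 (baseGraph D).ConnectedComponent :=
  Sym2.map (baseGraph D).connectedComponentMk e

end Problem

/-- In the multigraph with vertex set `W` in which the edge `e` has the ends `ends e` (loops and
parallel edges are allowed), the set `X` of edges contains no cycle: no edge of `X` has its two
ends joined by a walk along the other edges of `X`. -/
def IsForest {α W : Type*} (ends : α → Sym2 W) (X : Set α) : Prop :=
  ∀ e ∈ X, ∀ x y : W, ends e = s(x, y) →
    ¬ (SimpleGraph.fromEdgeSet (ends '' (X \ {e}))).Reachable x y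

/-- `M` is the graphic matroid, on its ground set, of the multigraph with the ends `ends`. -/
def IsGraphicMatroidOf {α W : Type*} (M : Matroid α) (ends : α → Sym2 W) : Prop :=
  ∀ X : Set α, M.Indep X ↔ X ⊆ M.E ∧ IsForest ends X

/-! ### Instances and their presentation to the machine -/

/-- A graph `G` with the vertices `0, …, n - 1`, a digraph `D` on its edges, a list of the `m`
edges of `G` by their ends, and a list of the `r` arcs of `D`, without repetitions, by the
positions of their tails and heads in the list of edges. -/
structure Instance where
  n : ℕ
  G : SimpleGraph (Fin n)
  D : Digraph G.edgeSet
  m : ℕ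
  edge : Fin m ≃ G.edgeSet
  fst : Fin m → Fin n
  snd : Fin m → Fin n
  edge_eq : ∀ i, (edge i : Sym2 (Fin n)) = s(fst i, snd i)
  r : ℕ
  tail : Fin r → Fin m
  head : Fin r → Fin m
  adj_iff : ∀ i j, D.Adj (edge i) (edge j) ↔ ∃ k, tail k = i ∧ head k = j
  arc_injective : Function.Injective fun k => (tail k, head k)

/-- The size of an instance: the number of vertices, edges and arcs. -/
def Instance.size (I : Instance) : ℕ := I.n + I.m + I.r

/-- A finite list of numbers as the contents of an array, padded with zeros. -/
def toArray {k b : ℕ} (f : Fin k → Fin b) (i : ℕ) : ℕ :=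
  if h : i < k then (f ⟨i, h⟩ : ℕ) else 0

/-- The initial store: the numbers `n`, `m`, `r` in the registers `0`, `1`, `2`, the two ends of
the edges in the arrays `0` and `1`, the tails and the heads of the arcs in the arrays `2` and
`3`; all else is zero. -/
def Instance.input (I : Instance) : Store where
  reg x := match x with
    | 0 => I.n
    | 1 => I.m
    | 2 => I.r
    | _ => 0
  arr a := match a with
    | 0 => toArray I.fst
    | 1 => toArray I.snd
    | 2 => toArray I.tail
    | 3 => toArray I.head
    | _ => fun _ => 0

end DCST

/-! Since ℓ(e) = u(e) = |dep(e)|, a spanning tree is feasible exactly when it contains dep(e) along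
with each of its edges e. Distinct arcs of D share no vertex, so every edge of S has a single
dependency, distinct edges of S have distinct dependencies, and all dependencies lie in G - S. Hence
the part X of a feasible tree inside S has dep(X) acyclic and, together with G - S, connects V.
Conversely, for such an X, extend dep(X) to a maximal forest of G - S and complete that forest to a
spanning tree by edges of X (`gdcst_iff`). Acyclicity of dep(X) is independence in M₁; connecting V
means that X contains an M₂-independent set of size k - 1 (`gdcst_iff_exists_indep`). Both matroids
come from linear independence of incidence columns over the field with two elements.

Polynomial time comes from matroid intersection. An inclusion-minimal vertex set carrying an
augmenting path can be switched in both matroids (`indep_symmDiff`); if there is no augmenting path,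
the set reachable from the sources certifies maximality (`encard_le_of_not_hasAugmentingPath`).
Closure in either matroid is connectivity in a graph, so every test of the algorithm is a
reachability question.

The program is not written out by hand. Predicates built from arithmetic, array access, bounded
quantifiers and iterated set comprehension are polynomial-time decidable (`PolyFun.sum`,
`polySet_stage`), and the algorithm is phrased as such a predicate, `Instance.Accepts`. Its nesting
depth is fixed, so the time bounds compose to one polynomial. -/

namespace DCST

/-! ### Running programs within a number of steps -/

/-- The program `p`, started in `s`, halts after at most `B` steps in a store satisfying `Q`. -/
def Runs (p : Prog) (s : Store) (B : ℕ) (Q : Store → Prop) : Prop :=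
  ∃ s' t, Exec p s s' t ∧ t ≤ B ∧ Q s'

section Runs

variable {p q : Prog} {s : Store} {B B' : ℕ} {Q Q' : Store → Prop} {x y z a c n : ℕ}

theorem Runs.mono (h : Runs p s B Q) (hB : B ≤ B') (hQ : ∀ s, Q s → Q' s) : Runs p s B' Q' := by
  obtain ⟨s', t, he, ht, hq⟩ := h
  exact ⟨s', t, he, ht.trans hB, hQ _ hq⟩

theorem Runs.seq (h : Runs p s B Q) (h' : ∀ s', Q s' → Runs q s' B' Q') :
    Runs (.seq p q) s (B + B') Q' := by
  obtain ⟨s', t, he, ht, hq⟩ := h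
  obtain ⟨s'', t', he', ht', hq'⟩ := h' s' hq
  exact ⟨s'', t + t', .seq he he', add_le_add ht ht', hq'⟩

theorem Runs.const (h : Q (s.setReg x c)) : Runs (.const x c) s 1 Q :=
  ⟨_, _, .const s x c, le_rfl, h⟩

theorem Runs.add (h : Q (s.setReg x (s.reg y + s.reg z))) : Runs (.add x y z) s 1 Q :=
  ⟨_, _, .add s x y z, le_rfl, h⟩

theorem Runs.sub (h : Q (s.setReg x (s.reg y - s.reg z))) : Runs (.sub x y z) s 1 Q :=
  ⟨_, _, .sub s x y z, le_rfl, h⟩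

theorem Runs.load (h : Q (s.setReg x (s.arr a (s.reg y)))) : Runs (.load x a y) s 1 Q :=
  ⟨_, _, .load s x a y, le_rfl, h⟩

theorem Runs.store (h : Q (s.setArr a (s.reg x) (s.reg y))) : Runs (.store a x y) s 1 Q :=
  ⟨_, _, .store s a x y, le_rfl, h⟩

/-- A loop whose body maintains an invariant that determines the counter and the bound. -/
theorem Runs.loop {Inv : ℕ → Store → Prop}
    (hinv : ∀ i s, Inv i s → s.reg x = i ∧ s.reg y = n)
    (hbody : ∀ i < n, ∀ s, Inv i s → Runs p s B (Inv (i + 1))) (h : Inv 0 s) :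
    Runs (.loop x y p) s (n * (B + 1) + 1) (Inv n) := by
  -- Induction on the number `k` of remaining rounds; the failing test at the end costs the last
  -- step.
  suffices H : ∀ k i s, i + k = n → Inv i s → Runs (.loop x y p) s (k * (B + 1) + 1) (Inv n) from
    H n 0 s (by omega) h
  intro k
  induction k with
  | zero =>
    rintro i s rfl h
    obtain ⟨h1, h2⟩ := hinv _ _ h
    exact ⟨s, 1, .loopDone (by simp [h1, h2]), by simp, h⟩
  | succ k ih =>
    rintro i s rfl h
    obtain ⟨h1, h2⟩ := hinv _ _ h
    obtain ⟨s', t, he, ht, hs'⟩ := hbody i (by omega) s h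
    obtain ⟨s'', t', he', ht', hs''⟩ := ih (i + 1) s' (by omega) hs'
    refine ⟨s'', t + t' + 1, .loopStep (by omega) he he', ?_, hs''⟩
    rw [Nat.succ_mul]
    omega

end Runs

@[simp] theorem Store.reg_setReg (s : Store) (x v : ℕ) :
    (s.setReg x v).reg = Function.update s.reg x v := rfl

@[simp] theorem Store.arr_setReg (s : Store) (x v : ℕ) : (s.setReg x v).arr = s.arr := rfl

@[simp] theorem Store.reg_setArr (s : Store) (a i v : ℕ) : (s.setArr a i v).reg = s.reg := rfl

@[simp] theorem Store.arr_setArr (s : Store) (a i v : ℕ) :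
    (s.setArr a i v).arr = Function.update s.arr a (Function.update (s.arr a) i v) := rfl

/-- The stores agree on the registers below `d` and on the arrays below `a`. -/
def Agree (d a : ℕ) (s s' : Store) : Prop :=
  (∀ x < d, s'.reg x = s.reg x) ∧ ∀ k < a, s'.arr k = s.arr k

namespace Agree

variable {d d' a a' x v : ℕ} {s s' s'' : Store}

theorem refl (d a : ℕ) (s : Store) : Agree d a s s := ⟨fun _ _ => rfl, fun _ _ => rfl⟩

theorem trans (h : Agree d a s s') (h' : Agree d' a' s' s'') (hd : d ≤ d') (ha : a ≤ a') :
    Agree d a s s'' :=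
  ⟨fun x hx => (h'.1 x (by omega)).trans (h.1 x hx),
    fun k hk => (h'.2 k (by omega)).trans (h.2 k hk)⟩

theorem mono (h : Agree d' a' s s') (hd : d ≤ d') (ha : a ≤ a') : Agree d a s s' :=
  (refl d a s).trans h hd ha

theorem setReg (h : Agree d a s s') (hx : d ≤ x) : Agree d a s (s'.setReg x v) := by
  refine ⟨fun y hy => ?_, h.2⟩
  rw [Store.reg_setReg, Function.update_of_ne (by omega), h.1 y hy]

end Agree

/-- Fill the entries of the array `tgt` up to the bound in register `y` by the values that `p`
leaves in register `x + 2`, with the counter in register `x`. -/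
def Prog.fill (tgt y x : ℕ) (p : Prog) : Prog :=
  .seq (.const x 0) (.seq (.const (x + 1) 1)
    (.loop x y (.seq p (.seq (.store tgt x (x + 2)) (.add x x (x + 1))))))

/-- The body may not rely on the array `tgt`, which is already partly overwritten. It must preserve
the registers below `x + 2`, because `x` and `x + 1` hold the counter and its increment 1. -/
theorem Runs.fill {tgt y x n m B : ℕ} {p : Prog} {s : Store} {f : ℕ → ℕ} (hy : y < x)
    (hn : s.reg y = n)
    (hbody : ∀ i < n, ∀ s', (∀ z < x, s'.reg z = s.reg z) → s'.reg x = i →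
      (∀ k < m, k ≠ tgt → s'.arr k = s.arr k) →
      Runs p s' B fun s'' => Agree (x + 2) m s' s'' ∧ s''.reg (x + 2) = f i) (ht : tgt < m) :
    Runs (.fill tgt y x p) s (n * (B + 3) + 3) fun s' =>
      (∀ z < x, s'.reg z = s.reg z) ∧ (∀ k < m, k ≠ tgt → s'.arr k = s.arr k) ∧
        ∀ i < n, s'.arr tgt i = f i := by
  let Inv : ℕ → Store → Prop := fun i s' => s'.reg x = i ∧ s'.reg (x + 1) = 1 ∧
    (∀ z < x, s'.reg z = s.reg z) ∧ (∀ k < m, k ≠ tgt → s'.arr k = s.arr k) ∧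
        ∀ j < i, s'.arr tgt j = f j
  have hloop := Runs.loop (x := x) (y := y) (n := n) (B := B + 2) (Inv := Inv)
    (p := .seq p (.seq (.store tgt x (x + 2)) (.add x x (x + 1))))
    (s := (s.setReg x 0).setReg (x + 1) 1)
    (fun i s' h => ⟨h.1, by rw [h.2.2.1 y hy, hn]⟩) ?_ ?_
  · refine Runs.mono (Runs.seq (Runs.const (Q := fun s' => s' = s.setReg x 0) rfl) ?_)
      (B := 1 + (1 + (n * (B + 2 + 1) + 1))) ?_ (fun _ h => h)
    · rintro _ rfl
      refine Runs.seq (Runs.const (Q := fun s' => s' = (s.setReg x 0).setReg (x + 1) 1) rfl) ?_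
      rintro _ rfl
      exact hloop.mono le_rfl fun s' h => ⟨h.2.2.1, h.2.2.2.1, h.2.2.2.2⟩
    · exact le_of_eq (by ring)
  · rintro i hi s' ⟨h1, h2, h3, h4, h5⟩
    refine Runs.mono (Runs.seq (hbody i hi s' h3 h1 h4)
      (B' := 1 + 1) ?_) le_rfl (fun _ h => h)
    rintro s'' ⟨h6, h7⟩
    refine Runs.seq (Runs.store (Q := fun s' => s' = s''.setArr tgt i (f i)) ?_) ?_
    · rw [h6.1 x (by omega), h1, h7]
    · rintro _ rfl
      have h8 := h6.1 x (by omega)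
      have h9 := h6.1 (x + 1) (by omega)
      refine Runs.add ⟨?_, ?_, ?_, ?_, ?_⟩
      · simp [h8, h9, h1, h2]
      · simp [h9, h2]
      · intro z hz
        rw [Store.reg_setReg, Function.update_of_ne (by omega)]
        exact (h6.1 z (by omega)).trans (h3 z hz)
      · intro k hk hkt
        simp only [Store.arr_setReg, Store.arr_setArr]
        rw [Function.update_of_ne hkt, h6.2 k hk, h4 k hk hkt]
      · intro j hj
        simp only [Store.arr_setReg, Store.arr_setArr, Function.update_self]
        rcases eq_or_ne j i with rfl | hji
        · simp
        · rw [Function.update_of_ne hji, h6.2 _ ht, h5 j (by omega)]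
  · refine ⟨by simp, by simp, fun z hz => ?_, fun k _ _ => rfl, fun j hj => by omega⟩
    simp only [Store.reg_setReg]
    rw [Function.update_of_ne (by omega), Function.update_of_ne (by omega)]

/-! ### Functions and predicates that are computable in polynomial time -/

/-- A way to keep the members of `Γ` in the registers below `d` and the arrays below `a`,
together with a number `N` that bounds loops and sizes of sets. -/
structure Rep (Γ : Type) where
  rel : Γ → Store → Prop
  d : ℕ
  a : ℕ
  N : Γ → ℕ
  nreg : ℕ
  nreg_lt : nreg < d
  reg_nreg : ∀ γ s, rel γ s → s.reg nreg = N γ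
  congr : ∀ γ s s', Agree d a s s' → rel γ s → rel γ s'

/-- One more number, kept in the register `k` above those of `R`. -/
def Rep.ext {Γ : Type} (R : Rep Γ) (k : ℕ) : Rep (Γ × ℕ) where
  rel p s := R.rel p.1 s ∧ s.reg (R.d + k) = p.2
  d := R.d + k + 1
  a := R.a
  N p := R.N p.1
  nreg := R.nreg
  nreg_lt := by have := R.nreg_lt; omega
  reg_nreg p s h := R.reg_nreg _ _ h.1
  congr p s s' h h' := ⟨R.congr _ _ _ (h.mono (by omega) le_rfl) h'.1,
    (h.1 _ (by omega)).trans h'.2⟩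

/-- One more set of numbers below `N`, kept in the array `l` above those of `R`. -/
def Rep.extSet {Γ : Type} (R : Rep Γ) (l : ℕ) : Rep (Γ × Set ℕ) where
  rel p s := R.rel p.1 s ∧ p.2 = {i | i < R.N p.1 ∧ s.arr (R.a + l) i ≠ 0}
  d := R.d
  a := R.a + l + 1
  N p := R.N p.1
  nreg := R.nreg
  nreg_lt := R.nreg_lt
  reg_nreg p s h := R.reg_nreg _ _ h.1
  congr p s s' h h' := ⟨R.congr _ _ _ (h.mono le_rfl (by omega)) h'.1,
    by rw [h.2 _ (by omega)]; exact h'.2⟩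

/-- `f` is computable in polynomial time, with any registers and arrays above those of `R` as
scratch space. -/
def PolyFun {Γ : Type} (R : Rep Γ) (f : Γ → ℕ) : Prop :=
  ∀ d ≥ R.d, ∀ a ≥ R.a, ∃ (P : Prog) (b : Polynomial ℕ), ∀ γ s, R.rel γ s →
    Runs P s (b.eval (R.N γ)) fun s' => Agree d a s s' ∧ s'.reg d = f γ

/-- `φ` is decidable in polynomial time. -/
def PolyDec {Γ : Type} (R : Rep Γ) (φ : Γ → Prop) : Prop :=
  ∃ f, PolyFun R f ∧ ∀ γ, f γ ≠ 0 ↔ φ γ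

/-- The array `X` is part of the representation. -/
def Arr {Γ : Type} (R : Rep Γ) (X : Γ → ℕ → ℕ) : Prop :=
  ∃ k < R.a, ∀ γ s, R.rel γ s → s.arr k = X γ

/-- The set `X` is computable in polynomial time. -/
def PolySet {Γ : Type} (R : Rep Γ) (X : Γ → Set ℕ) : Prop :=
  ∀ d ≥ R.d, ∀ a ≥ R.a, ∃ (P : Prog) (b : Polynomial ℕ), ∀ γ s, R.rel γ s →
    Runs P s (b.eval (R.N γ)) fun s' => Agree d a s s' ∧
      X γ = {i | i < R.N γ ∧ s'.arr a i ≠ 0}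

/-- The set `X` is part of the representation. -/
def SetVar {Γ : Type} (R : Rep Γ) (X : Γ → Set ℕ) : Prop :=
  ∃ k < R.a, ∀ γ s, R.rel γ s → X γ = {i | i < R.N γ ∧ s.arr k i ≠ 0}


/-! ### Closure properties of polynomial-time computability -/

section Closure

variable {Γ : Type} {R : Rep Γ} {f g : Γ → ℕ} {φ ψ : Γ → Prop} {X : Γ → Set ℕ} {A : Γ → ℕ → ℕ}

theorem PolyFun.weaken {Δ : Type} {R' : Rep Δ} (h : Δ → Γ)
    (hrel : ∀ δ s, R'.rel δ s → R.rel (h δ) s)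
    (hd : R.d ≤ R'.d) (ha : R.a ≤ R'.a) (hN : ∀ δ, R'.N δ = R.N (h δ)) (hf : PolyFun R f) :
    PolyFun R' fun δ => f (h δ) := by
  intro d hd' a ha'
  obtain ⟨P, b, H⟩ := hf d (hd.trans hd') a (ha.trans ha')
  refine ⟨P, b, fun δ s hs => ?_⟩
  rw [hN]
  exact H _ s (hrel δ s hs)

theorem PolyFun.ext (hf : PolyFun R f) (k : ℕ) : PolyFun (R.ext k) fun p => f p.1 :=
  hf.weaken Prod.fst (fun _ _ h => h.1) (by simp [Rep.ext]; omega) le_rfl fun _ => rfl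

theorem PolyFun.extSet (hf : PolyFun R f) (l : ℕ) : PolyFun (R.extSet l) fun p => f p.1 :=
  hf.weaken Prod.fst (fun _ _ h => h.1) le_rfl (by simp [Rep.extSet]; omega) fun _ => rfl

theorem Arr.ext (h : Arr R A) (k : ℕ) : Arr (R.ext k) fun p => A p.1 := by
  obtain ⟨j, hj, H⟩ := h
  exact ⟨j, hj, fun p s hs => H _ s hs.1⟩

theorem SetVar.ext (h : SetVar R X) (k : ℕ) : SetVar (R.ext k) fun p => X p.1 := by
  obtain ⟨j, hj, H⟩ := h
  exact ⟨j, hj, fun p s hs => H _ s hs.1⟩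

theorem setVar_snd (l : ℕ) : SetVar (R.extSet l) Prod.snd :=
  ⟨R.a + l, by simp [Rep.extSet], fun _ _ h => h.2⟩

theorem polyFun_reg {x : ℕ} (hx : x < R.d) (h : ∀ γ s, R.rel γ s → s.reg x = f γ) :
    PolyFun R f := by
  intro d hd a _
  refine ⟨.seq (.const d 0) (.add d d x), 2, fun γ s hs => ?_⟩
  refine (Runs.seq (B := 1) (B' := 1) (Runs.const (Q := fun s' => s' = s.setReg d 0) rfl)
    ?_).mono (by simp) fun _ h => h
  rintro _ rfl
  refine Runs.add ⟨((Agree.refl _ _ _).setReg le_rfl).setReg le_rfl, ?_⟩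
  have hxd : x ≠ d := by omega
  simp [hxd, h γ s hs]

theorem polyFun_snd (k : ℕ) : PolyFun (R.ext k) Prod.snd :=
  polyFun_reg (x := R.d + k) (by simp [Rep.ext]) fun _ _ h => h.2

theorem polyFun_const (c : ℕ) : PolyFun R fun _ => c := by
  intro d hd a _
  refine ⟨.const d c, 1, fun γ s hs => (Runs.const ?_).mono (by simp) fun _ h => h⟩
  exact ⟨(Agree.refl _ _ _).setReg le_rfl, by simp⟩

theorem PolyFun.congr (hf : PolyFun R f) (h : ∀ γ, f γ = g γ) : PolyFun R g := by
  rwa [show g = f from funext fun γ => (h γ).symm]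

/-- Evaluation on a stack: the first value stays in register `d` while the second is computed with
scratch space from `d + 1` on. This is why computability is required for every choice of scratch
space. -/
theorem PolyFun.binop {F : ℕ → ℕ → ℕ} (op : ℕ → Prog) (c : ℕ)
    (hop : ∀ d a s, Runs (op d) s c fun s' => Agree d a s s' ∧
      s'.reg d = F (s.reg d) (s.reg (d + 1)))
    (hf : PolyFun R f) (hg : PolyFun R g) : PolyFun R fun γ => F (f γ) (g γ) := by
  intro d hd a ha
  obtain ⟨P, b, hP⟩ := hf d hd a ha
  obtain ⟨P', b', hP'⟩ := hg (d + 1) (by omega) a ha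
  refine ⟨.seq P (.seq P' (op d)), b + (b' + Polynomial.C c), fun γ s hs => ?_⟩
  refine (Runs.seq (hP γ s hs) fun s₁ h₁ => ?_).mono (Polynomial.eval_add ..).ge fun _ h => h
  refine (Runs.seq (hP' γ s₁ (R.congr _ _ _ (h₁.1.mono hd ha) hs)) fun s₂ h₂ => ?_).mono
    (Polynomial.eval_add ..).ge fun _ h => h
  refine (hop d a s₂).mono (by simp) fun s₃ h₃ =>
    ⟨(h₁.1.trans h₂.1 (by omega) le_rfl).trans h₃.1 le_rfl le_rfl, ?_⟩
  rw [h₃.2, h₂.2, h₂.1.1 d (by omega), h₁.2]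

theorem PolyFun.add (hf : PolyFun R f) (hg : PolyFun R g) : PolyFun R fun γ => f γ + g γ :=
  PolyFun.binop (fun d => .add d d (d + 1)) 1
    (fun _ _ _ => Runs.add ⟨(Agree.refl _ _ _).setReg le_rfl, by simp⟩) hf hg

theorem PolyFun.sub (hf : PolyFun R f) (hg : PolyFun R g) : PolyFun R fun γ => f γ - g γ :=
  PolyFun.binop (fun d => .sub d d (d + 1)) 1
    (fun _ _ _ => Runs.sub ⟨(Agree.refl _ _ _).setReg le_rfl, by simp⟩) hf hg

theorem Arr.get (hA : Arr R A) (hf : PolyFun R f) : PolyFun R fun γ => A γ (f γ) := by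
  obtain ⟨k, hk, H⟩ := hA
  intro d hd a ha
  obtain ⟨P, b, hP⟩ := hf d hd a ha
  refine ⟨.seq P (.load d k d), b + 1, fun γ s hs => ?_⟩
  refine (Runs.seq (hP γ s hs) fun s₁ h₁ => ?_).mono (Polynomial.eval_add ..).ge fun _ h => h
  refine (Runs.load ?_).mono (by simp) fun _ h => h
  refine ⟨h₁.1.setReg le_rfl, ?_⟩
  rw [Store.reg_setReg, Function.update_self, h₁.2, h₁.1.2 k (by omega), H γ s hs]

theorem SetVar.polySet (h : SetVar R X) : PolySet R X := by
  obtain ⟨k, hk, H⟩ := h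
  intro d hd a ha
  refine ⟨.fill a R.nreg d (.load (d + 2) k d), Polynomial.X * 4 + 3, fun γ s hs => ?_⟩
  refine (Runs.fill (m := a + 1) (B := 1) (f := s.arr k) (hd.trans_lt' R.nreg_lt)
    (R.reg_nreg _ _ hs) (fun i hi s' h1 h2 h3 => ?_) (by omega)).mono (by simp) ?_
  · refine Runs.load ⟨(Agree.refl _ _ _).setReg le_rfl, ?_⟩
    simp [h2, h3 k (by omega) (by omega)]
  · rintro s' ⟨h1, h2, h3⟩
    refine ⟨⟨h1, fun j hj => h2 j (by omega) (by omega)⟩, ?_⟩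
    rw [H γ s hs]
    ext i
    simp only [Set.mem_ofPred_eq]
    exact and_congr_right fun hi => by rw [h3 i hi]

theorem PolySet.mem (hX : PolySet R X) (hf : PolyFun R f) : PolyDec R fun γ => f γ ∈ X γ := by
  classical
  refine ⟨fun γ => if f γ ∈ X γ then 1 else 0, ?_, fun γ => by simp⟩
  intro d hd a ha
  obtain ⟨P, b, hP⟩ := hX d hd a ha
  obtain ⟨P', b', hP'⟩ := hf d hd (a + 1) (by omega)
  -- With v the value of `f` and w the entry of the array at v, the code computes (N - v) - ((N - v)
  -- - w) = min(N - v, w), which is nonzero iff v < N and w ≠ 0, and then turns it into 0 or 1 by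
  -- subtracting from 1 twice. Entries beyond N are arbitrary, hence the guard.
  refine ⟨.seq P (.seq P' (.seq (.load (d + 1) a d) (.seq (.sub d R.nreg d)
    (.seq (.sub (d + 2) d (d + 1)) (.seq (.sub d d (d + 2)) (.seq (.const (d + 1) 1)
    (.seq (.sub d (d + 1) d) (.sub d (d + 1) d)))))))),
    b + (b' + 7), fun γ s hs => ?_⟩
  refine (Runs.seq (hP γ s hs) fun s₁ h₁ => ?_).mono (Polynomial.eval_add ..).ge fun _ h => h
  have hs₁ := R.congr _ _ _ (h₁.1.mono hd ha) hs
  refine (Runs.seq (hP' γ s₁ hs₁) fun s₂ h₂ => ?_).mono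
    (Polynomial.eval_add ..).ge fun _ h => h
  have hs₂ := R.congr _ _ _ (h₂.1.mono hd (by omega)) hs₁
  have hN := R.reg_nreg _ _ hs₂
  have hlt := R.nreg_lt
  have hAg : Agree d a s s₂ := h₁.1.trans h₂.1 le_rfl (by omega)
  refine Runs.mono (B := 1 + (1 + (1 + (1 + (1 + (1 + 1)))))) ?_ (by simp) fun _ h => h
  refine Runs.seq (Runs.load (Q := fun s' => s' = s₂.setReg (d + 1) (s₂.arr a (f γ))) ?_) ?_
  · rw [h₂.2]
  rintro _ rfl
  refine Runs.seq (Runs.sub rfl) ?_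
  rintro _ rfl
  refine Runs.seq (Runs.sub rfl) ?_
  rintro _ rfl
  refine Runs.seq (Runs.sub rfl) ?_
  rintro _ rfl
  refine Runs.seq (Runs.const rfl) ?_
  rintro _ rfl
  refine Runs.seq (Runs.sub rfl) ?_
  rintro _ rfl
  refine Runs.sub ⟨?_, ?_⟩
  · refine (((((((hAg.setReg ?_).setReg ?_).setReg ?_).setReg ?_).setReg ?_).setReg ?_).setReg ?_)
      <;> omega
  · have e1 : R.nreg ≠ d + 1 := by omega
    have e3 : d ≠ d + 2 := by omega
    have e5 : s₂.reg d = f γ := h₂.2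
    have e6 : f γ ∈ X γ ↔ f γ < R.N γ ∧ s₂.arr a (f γ) ≠ 0 := by
      rw [h₁.2, h₂.1.2 a (by omega)]; rfl
    simp only [Store.reg_setReg, Function.update_self, ne_eq, e1, e3, not_false_eq_true,
      Function.update_of_ne, hN, e5, Nat.left_eq_add, Nat.add_eq_left, one_ne_zero, e6]
    split_ifs <;> simp_all <;> omega

theorem PolyDec.congr (h : PolyDec R φ) (H : ∀ γ, φ γ ↔ ψ γ) : PolyDec R ψ := by
  rwa [show ψ = φ from funext fun γ => propext (H γ).symm]

/-- A truth value is any number, nonzero meaning true, so truncated subtraction and addition provide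
comparison, negation and disjunction. -/
theorem PolyFun.lt (hf : PolyFun R f) (hg : PolyFun R g) : PolyDec R fun γ => f γ < g γ :=
  ⟨_, hg.sub hf, fun γ => by omega⟩

theorem PolyDec.not (h : PolyDec R φ) : PolyDec R fun γ => ¬ φ γ := by
  obtain ⟨f, hf, H⟩ := h
  exact ⟨_, (polyFun_const 1).sub hf, fun γ => by have := H γ; grind⟩

theorem PolyDec.or (h : PolyDec R φ) (h' : PolyDec R ψ) : PolyDec R fun γ => φ γ ∨ ψ γ := by
  obtain ⟨f, hf, H⟩ := h
  obtain ⟨g, hg, H'⟩ := h'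
  exact ⟨_, hf.add hg, fun γ => by have := H γ; have := H' γ; grind⟩

theorem PolyDec.and (h : PolyDec R φ) (h' : PolyDec R ψ) : PolyDec R fun γ => φ γ ∧ ψ γ :=
  (h.not.or h'.not).not.congr fun γ => by tauto

theorem PolyFun.eq (hf : PolyFun R f) (hg : PolyFun R g) : PolyDec R fun γ => f γ = g γ :=
  ((hf.lt hg).or (hg.lt hf)).not.congr fun γ => by omega

/-- The loop from which bounded quantifiers are derived: an existential statement holds iff the
number of its witnesses, a sum of indicators, is nonzero. -/
theorem PolyFun.sum {f : Γ × ℕ → ℕ} (hf : ∀ k, PolyFun (R.ext k) f) :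
    PolyFun R fun γ => ∑ i ∈ Finset.range (R.N γ), f (γ, i) := by
  intro d hd a ha
  -- The counter sits above the accumulator `d`, at a position known only once `d` is chosen;
  -- therefore `hf` is assumed for all offsets `k`.
  have hk : R.d + (d + 1 - R.d) = d + 1 := by omega
  obtain ⟨P, b, hP⟩ := hf (d + 1 - R.d) (d + 3) (by simp only [Rep.ext]; omega) a ha
  simp only [Rep.ext, hk] at hP
  refine ⟨.seq (.const d 0) (.seq (.const (d + 1) 0) (.seq (.const (d + 2) 1)
    (.loop (d + 1) R.nreg (.seq P (.seq (.add d d (d + 3)) (.add (d + 1) (d + 1) (d + 2))))))),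
    3 + (Polynomial.X * (b + 3) + 1), fun γ s hs => ?_⟩
  have hlt := R.nreg_lt
  let Inv : ℕ → Store → Prop := fun i s' => Agree d a s s' ∧
    s'.reg d = ∑ j ∈ Finset.range i, f (γ, j) ∧ s'.reg (d + 1) = i ∧ s'.reg (d + 2) = 1
  refine Runs.mono (B := 1 + (1 + (1 + (R.N γ * (b.eval (R.N γ) + 2 + 1) + 1)))) ?_
    (le_of_eq (by simp; ring)) fun _ h => h
  refine Runs.seq (Runs.const rfl) ?_
  rintro _ rfl
  refine Runs.seq (Runs.const rfl) ?_
  rintro _ rfl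
  refine Runs.seq (Runs.const rfl) ?_
  rintro _ rfl
  refine (Runs.loop (Inv := Inv) (fun i s' h => ⟨h.2.2.1, ?_⟩) ?_ ?_).mono le_rfl
    fun s' h => ⟨h.1, h.2.1⟩
  · rw [h.1.1 _ (by omega), R.reg_nreg _ _ hs]
  · rintro i hi s₁ ⟨h1, h2, h3, h4⟩
    refine Runs.seq (hP (γ, i) s₁ ⟨R.congr _ _ _ (h1.mono hd ha) hs, h3⟩) (B' := 1 + 1) ?_
    rintro s₂ ⟨h5, h6⟩
    refine Runs.seq (Runs.add rfl) ?_
    rintro _ rfl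
    refine Runs.add ⟨?_, ?_, ?_, ?_⟩
    · exact (((h1.trans h5 (by omega) le_rfl).setReg le_rfl).setReg (by omega))
    · simp [Finset.sum_range_succ, h6, h5.1 d (by omega), h2]
    · simp [h5.1 (d + 1) (by omega), h5.1 (d + 2) (by omega), h3, h4]
    · simp [h5.1 (d + 2) (by omega), h4]
  · refine ⟨(((Agree.refl _ _ _).setReg le_rfl).setReg ?_).setReg ?_, ?_, ?_, ?_⟩ <;> simp

open Classical in
theorem PolyDec.indicator (h : PolyDec R φ) : PolyFun R fun γ => if φ γ then 1 else 0 := by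
  obtain ⟨f, hf, H⟩ := h
  refine ((polyFun_const 1).sub ((polyFun_const 1).sub hf)).congr fun γ => ?_
  have := H γ
  split_ifs <;> grind

theorem PolyDec.exists_lt {φ : Γ → ℕ → Prop} (h : ∀ k, PolyDec (R.ext k) fun p => φ p.1 p.2) :
    PolyDec R fun γ => ∃ i < R.N γ, φ γ i := by
  classical
  refine ⟨_, PolyFun.sum fun k => (h k).indicator, fun γ => ?_⟩
  simp

theorem PolyDec.exists_lt_of_le {φ : Γ → ℕ → Prop} (hf : PolyFun R f) (hle : ∀ γ, f γ ≤ R.N γ)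
    (h : ∀ k, PolyDec (R.ext k) fun p => φ p.1 p.2) :
    PolyDec R fun γ => ∃ i < f γ, φ γ i :=
  (exists_lt (φ := fun γ i => i < f γ ∧ φ γ i)
    fun k => ((polyFun_snd k).lt (hf.ext k)).and (h k)).congr fun γ =>
    ⟨fun ⟨i, _, h⟩ => ⟨i, h⟩, fun ⟨i, h⟩ => ⟨i, h.1.trans_le (hle γ), h⟩⟩

theorem PolyDec.forall_lt_of_le {φ : Γ → ℕ → Prop} (hf : PolyFun R f) (hle : ∀ γ, f γ ≤ R.N γ)
    (h : ∀ k, PolyDec (R.ext k) fun p => φ p.1 p.2) :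
    PolyDec R fun γ => ∀ i < f γ, φ γ i :=
  (exists_lt_of_le (φ := fun γ i => ¬ φ γ i) hf hle fun k => (h k).not).not.congr
    fun γ => by grind

end Closure

/-! ### Iterated comprehension -/

/-- The sets obtained from the empty set by iterating the comprehension
`X ↦ {i | i < N ∧ φ X t i}`, where `t` is the number of the round. -/
def stage (φ : Set ℕ → ℕ → ℕ → Prop) (N : ℕ) : ℕ → Set ℕ
  | 0 => ∅
  | t + 1 => {i | i < N ∧ φ (stage φ N t) t i}

theorem polySet_stage {Γ : Type} {R : Rep Γ} {φ : Γ → Set ℕ → ℕ → ℕ → Prop}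
    (h : ∀ l k k', PolyDec (((R.extSet l).ext k).ext k')
      fun p => φ p.1.1.1 p.1.1.2 p.1.2 p.2) :
    PolySet R fun γ => stage (φ γ) (R.N γ) (R.N γ) := by
  classical
  intro d hd a ha
  have hk : R.d + (d - R.d) = d := by omega
  have hk' : d + 1 + 1 = d + 2 := by omega
  have hl : R.a + (a - R.a) = a := by omega
  obtain ⟨P, b, hP⟩ := (h (a - R.a) (d - R.d) 1).indicator (d + 4)
    (by simp only [Rep.ext, Rep.extSet]; omega) (a + 2) (by simp only [Rep.ext, Rep.extSet]; omega)
  simp only [Rep.ext, Rep.extSet, hk, hk', hl] at hP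
  have hlt := R.nreg_lt
  -- Register `d` holds the round, `d + 1` the constant 1, `d + 2` the element under test. The new
  -- set is built in array `a + 1` and then copied to `a`, so that `P` reads the unmodified old set
  -- throughout a round.
  refine ⟨.seq (.fill a R.nreg (d + 2) (.const (d + 4) 0)) (.seq (.const d 0)
    (.seq (.const (d + 1) 1) (.loop d R.nreg
      (.seq (.fill (a + 1) R.nreg (d + 2) P)
      (.seq (.fill a R.nreg (d + 2) (.load (d + 4) (a + 1) (d + 2))) (.add d d (d + 1))))))),
    (Polynomial.X * 4 + 3) + (1 + (1 + (Polynomial.X *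
      ((Polynomial.X * (b + 3) + 3) + ((Polynomial.X * 4 + 3) + 1) + 1) + 1))), fun γ s hs => ?_⟩
  have hN : ∀ s', Agree d a s s' → s'.reg R.nreg = R.N γ := fun s' h =>
    R.reg_nreg _ _ (R.congr _ _ _ (h.mono hd ha) hs)
  let Inv : ℕ → Store → Prop := fun t s' => Agree d a s s' ∧
    stage (φ γ) (R.N γ) t = {i | i < R.N γ ∧ s'.arr a i ≠ 0} ∧ s'.reg d = t ∧ s'.reg (d + 1) = 1
  simp only [Polynomial.eval_add, Polynomial.eval_mul, Polynomial.eval_X, Polynomial.eval_one,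
    Polynomial.eval_ofNat]
  refine Runs.seq (Runs.fill (m := a + 1) (B := 1) (f := fun _ => 0) (by omega)
    (hN _ (Agree.refl _ _ _)) (fun i hi s' _ _ _ => ?_) (by omega)) ?_
  · exact Runs.const ⟨(Agree.refl _ _ _).setReg le_rfl, by simp⟩
  rintro s₁ ⟨h1, h2, h3⟩
  refine Runs.seq (Runs.const rfl) ?_
  rintro _ rfl
  refine Runs.seq (Runs.const rfl) ?_
  rintro _ rfl
  refine (Runs.loop (Inv := Inv) (fun i s' h => ⟨h.2.2.1, hN _ h.1⟩) ?_ ?_).mono le_rfl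
    fun s' h => ⟨h.1, h.2.1⟩
  · rintro t ht s₂ ⟨h4, h5, h6, h7⟩
    refine Runs.seq (Runs.fill (m := a + 2) (B := b.eval (R.N γ))
      (f := fun i => if φ γ (stage (φ γ) (R.N γ) t) t i then 1 else 0) (by omega)
      (hN _ h4) (fun i hi s' h8 h9 h10 => ?_) (by omega)) ?_
    · refine hP (((γ, stage (φ γ) (R.N γ) t), t), i) s' ⟨⟨⟨?_, ?_⟩, ?_⟩, h9⟩
      · exact R.congr _ _ _ ⟨fun z hz => by rw [h8 z (by omega), h4.1 z (by omega)],
          fun k hk => by rw [h10 k (by omega) (by omega), h4.2 k (by omega)]⟩ hs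
      · rw [h5, h10 a (by omega) (by omega)]
      · rw [h8 d (by omega), h6]
    rintro s₃ ⟨h8, h9, h10⟩
    have h11 : Agree d a s s₃ := ⟨fun z hz => by rw [h8 z (by omega), h4.1 z (by omega)],
          fun k hk => by rw [h9 k (by omega) (by omega), h4.2 k (by omega)]⟩
    refine Runs.seq (Runs.fill (m := a + 2) (B := 1) (f := s₃.arr (a + 1)) (by omega)
      (hN _ h11) (fun i hi s' h12 h13 h14 => ?_) (by omega)) ?_
    · refine Runs.load ⟨(Agree.refl _ _ _).setReg le_rfl, ?_⟩
      simp [h13, h14 (a + 1) (by omega) (by omega)]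
    rintro s₄ ⟨h12, h13, h14⟩
    refine Runs.add ⟨Agree.setReg ?_ le_rfl, ?_, ?_, ?_⟩
    · exact ⟨fun z hz => by rw [h12 z (by omega), h11.1 z (by omega)],
          fun k hk => by rw [h13 k (by omega) (by omega), h11.2 k (by omega)]⟩
    · ext i
      simp only [stage, Set.mem_ofPred_eq, Store.arr_setReg]
      refine and_congr_right fun hi => ?_
      rw [h14 i hi, h10 i hi]
      simp
    · simp [h12 d (by omega), h12 (d + 1) (by omega), h8 d (by omega), h8 (d + 1) (by omega),
        h6, h7]
    · simp [h12 (d + 1) (by omega), h8 (d + 1) (by omega), h7]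
  · refine ⟨Agree.setReg (Agree.setReg ⟨fun z hz => h1 z (by omega),
      fun k hk => h2 k (by omega) (by omega)⟩ le_rfl) (by omega), ?_, by simp, by simp⟩
    ext i
    simp only [stage, Set.mem_empty_iff_false, Set.mem_ofPred_eq, Store.arr_setReg, false_iff]
    exact fun h => h.2 (h3 i h.1)

theorem stage_subset (φ : Set ℕ → ℕ → ℕ → Prop) (N t : ℕ) : stage φ N t ⊆ Set.Iio N := by
  cases t with
  | zero => exact Set.empty_subset _
  | succ t => exact fun i h => h.1

/-! ### Reachability -/

/-- `y` can be reached from `x` along the arcs `φ` between numbers below `N`. -/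
def Reach (N : ℕ) (φ : ℕ → ℕ → Prop) (x y : ℕ) : Prop :=
  x < N ∧ Relation.ReflTransGen (fun u v => u < N ∧ v < N ∧ φ u v) x y

/-- Breadth-first search. The stages increase inside a set of N numbers, and once two consecutive
ones agree they stay constant, so N rounds reach the fixed point. -/
theorem mem_stage_iff_reach {N x y : ℕ} {φ : ℕ → ℕ → Prop} :
    y ∈ stage (fun X _ i => i = x ∨ ∃ j < N, j ∈ X ∧ φ j i) N N ↔ Reach N φ x y := by
  set ψ : Set ℕ → ℕ → ℕ → Prop := fun X _ i => i = x ∨ ∃ j < N, j ∈ X ∧ φ j i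
  have hmono : ∀ t, stage ψ N t ⊆ stage ψ N (t + 1) := by
    intro t
    induction t with
    | zero => exact Set.empty_subset _
    | succ t ih =>
      rintro i ⟨hi, h | ⟨j, hj, hjt, h⟩⟩
      · exact ⟨hi, .inl h⟩
      · exact ⟨hi, .inr ⟨j, hj, ih hjt, h⟩⟩
  have hfin : ∀ t, (stage ψ N t).Finite := fun t =>
    (Set.finite_Iio N).subset (stage_subset ψ N t)
  -- Every round before stabilisation gains at least one element.
  have hcard : ∀ t, t ≤ (stage ψ N t).ncard ∨ stage ψ N (t + 1) = stage ψ N t := by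
    intro t
    induction t with
    | zero => simp
    | succ t ih =>
      rcases eq_or_ne (stage ψ N (t + 1)) (stage ψ N t) with h | h
      · right
        conv_rhs => rw [stage]
        conv_lhs => rw [stage, h]
      · left
        rcases ih with ih | ih
        · have := Set.ncard_lt_ncard ((hmono t).ssubset_of_ne h.symm) (hfin _)
          omega
        · exact absurd ih h
  have hclosed : stage ψ N (N + 1) = stage ψ N N := by
    rcases hcard N with h | h
    · have hN : stage ψ N N = Set.Iio N := by
        refine Set.eq_of_subset_of_ncard_le (stage_subset ψ N N) ?_ (Set.finite_Iio N)
        simpa [Set.ncard_eq_toFinset_card'] using h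
      exact ((stage_subset ψ N _).trans hN.ge).antisymm (hmono N)
    · exact h
  constructor
  · have H : ∀ t, ∀ y ∈ stage ψ N t, Reach N φ x y := by
      intro t
      induction t with
      | zero => exact fun y hy => hy.elim
      | succ t ih =>
        rintro y ⟨hy, rfl | ⟨j, hj, hjt, h⟩⟩
        · exact ⟨hy, .refl⟩
        · exact ⟨(ih j hjt).1, (ih j hjt).2.tail ⟨hj, hy, h⟩⟩
    exact H N y
  · rintro ⟨hx, h⟩
    induction h with
    | refl => rw [← hclosed]; exact ⟨hx, .inl rfl⟩
    | tail _ h ih => rw [← hclosed]; exact ⟨h.2.1, .inr ⟨_, h.1, ih, h.2.2⟩⟩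

theorem PolyDec.reach {Γ : Type} {R : Rep Γ} {φ : Γ → ℕ → ℕ → Prop} {x y : Γ → ℕ}
    (h : ∀ l k k' k'', PolyDec ((((R.extSet l).ext k).ext k').ext k'')
      fun p => φ p.1.1.1.1 p.2 p.1.2)
    (hx : PolyFun R x) (hy : PolyFun R y) :
    PolyDec R fun γ => Reach (R.N γ) (φ γ) (x γ) (y γ) := by
  refine (PolySet.mem (polySet_stage
    (φ := fun γ X _ i => i = x γ ∨ ∃ j < R.N γ, j ∈ X ∧ φ γ j i) fun l k k' => ?_) hy).congr
    fun γ => mem_stage_iff_reach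
  refine PolyDec.or ((polyFun_snd _).eq (((hx.extSet l).ext k).ext k')) ?_
  refine PolyDec.exists_lt (R := ((R.extSet l).ext k).ext k')
    (φ := fun p j => j ∈ p.1.1.2 ∧ φ p.1.1.1 j p.2) fun k'' => PolyDec.and ?_ (h l k k' k'')
  exact ((((setVar_snd l).ext k).ext k').ext k'').polySet.mem (polyFun_snd _)


/-! ### Chordless paths -/

section Paths

variable {α : Type*} {r : α → α → Prop} {s t : α → Prop} {W W' : Set α}

/-- There is a path within `W`, along the relation `r`, from `s` to `t`. -/
def HasPath (r : α → α → Prop) (s t : α → Prop) (W : Set α) : Prop :=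
  ∃ a ∈ W, ∃ b ∈ W, s a ∧ t b ∧ Relation.ReflTransGen (fun u v => u ∈ W ∧ v ∈ W ∧ r u v) a b

theorem HasPath.mono (h : HasPath r s t W) (hW : W ⊆ W') : HasPath r s t W' := by
  obtain ⟨a, ha, b, hb, hs, ht, h⟩ := h
  exact ⟨a, hW ha, b, hW hb, hs, ht,
    Relation.ReflTransGen.mono (fun u v h => ⟨hW h.1, hW h.2.1, h.2.2⟩) _ _ h⟩

/-- The sequence `p` is a path of length `L` within `W`, along the relation `r`,
from `s` to `t`. -/
structure IsPathSeq (r : α → α → Prop) (s t : α → Prop) (W : Set α) (L : ℕ) (p : ℕ → α) :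
    Prop where
  mem : ∀ i ≤ L, p i ∈ W
  source : s (p 0)
  sink : t (p L)
  step : ∀ i < L, r (p i) (p (i + 1))

theorem hasPath_iff : HasPath r s t W ↔ ∃ L p, IsPathSeq r s t W L p := by
  constructor
  · rintro ⟨a, ha, b, hb, hs, ht, h⟩
    suffices H : ∃ (L : ℕ) (p : ℕ → α), p 0 = a ∧ p L = b ∧ (∀ i ≤ L, p i ∈ W) ∧
        ∀ i < L, r (p i) (p (i + 1)) by
      obtain ⟨L, p, rfl, rfl, h1, h2⟩ := H
      exact ⟨L, p, h1, hs, ht, h2⟩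
    clear ht hb
    induction h with
    | refl => exact ⟨0, fun _ => a, rfl, rfl, fun _ _ => ha, fun i hi => by omega⟩
    | @tail b c _ h ih =>
      obtain ⟨L, p, rfl, rfl, h1, h2⟩ := ih
      refine ⟨L + 1, fun i => if i ≤ L then p i else c, by simp, by simp, fun i hi => ?_,
        fun i hi => ?_⟩
      · by_cases h' : i ≤ L
        · simpa [h'] using h1 i h'
        · simpa [h'] using h.2.1
      · by_cases h' : i < L
        · have h'' : i ≤ L := h'.le
          have : i + 1 ≤ L := h'
          simpa [h'', this] using h2 i h'
        · obtain rfl : i = L := by omega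
          simpa using h.2.2
  · rintro ⟨L, p, h1, h2, h3, h4⟩
    refine ⟨p 0, h1 0 (by omega), p L, h1 L le_rfl, h2, h3, ?_⟩
    suffices H : ∀ i ≤ L, Relation.ReflTransGen (fun u v => u ∈ W ∧ v ∈ W ∧ r u v) (p 0) (p i) from
      H L le_rfl
    intro i
    induction i with
    | zero => exact fun _ => .refl
    | succ i ih => exact fun hi =>
        (ih (by omega)).tail ⟨h1 i (by omega), h1 _ hi, h4 i (by omega)⟩

/-- A minimal set that contains a path is the set of the vertices of a chordless path, and only
the ends of this path are in `s` and in `t`. -/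
theorem exists_chordless (h : HasPath r s t W) (hmin : ∀ w ∈ W, ¬ HasPath r s t (W \ {w})) :
    ∃ L p, IsPathSeq r s t W L p ∧ W = {a | ∃ i ≤ L, p i = a} ∧
      (∀ i j, i + 1 < j → j ≤ L → ¬ r (p i) (p j)) ∧ (∀ i ≤ L, 0 < i → ¬ s (p i)) ∧
      ∀ i < L, ¬ t (p i) := by
  classical
  have hex := hasPath_iff.1 h
  obtain ⟨p, hp⟩ := Nat.find_spec hex
  -- Two minimalities cooperate: that of `W` under inclusion forces it to consist of path vertices
  -- only, and that of the length `L` rules out chords and further sources or sinks.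
  have hlt : ∀ L' < Nat.find hex, ∀ q, ¬ IsPathSeq r s t W L' q := fun L' hL' q hq =>
    Nat.find_min hex hL' ⟨q, hq⟩
  generalize Nat.find hex = L at *
  refine ⟨L, p, hp, ?_, fun i j hij hj hr => ?_, fun i hi h0 hs => ?_, fun i hi ht => ?_⟩
  · ext a
    refine ⟨fun ha => ?_, ?_⟩
    · by_contra hne
      exact hmin a ha (hasPath_iff.2 ⟨L, p, fun i hi => ⟨hp.mem i hi, fun h => hne ⟨i, hi, h⟩⟩,
        hp.source, hp.sink, hp.step⟩)
    · rintro ⟨i, hi, rfl⟩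
      exact hp.mem i hi
  -- A chord from position i to position j bypasses the j - i - 1 vertices in between.
  · refine hlt (L - (j - i - 1)) (by omega) (fun k => if k ≤ i then p k else p (k + (j - i - 1)))
      ⟨fun k hk => ?_, by simpa using hp.source, ?_, fun k hk => ?_⟩
    · split_ifs
      · exact hp.mem k (by omega)
      · exact hp.mem _ (by omega)
    · have h1 : ¬ L - (j - i - 1) ≤ i := by omega
      have h2 : L - (j - i - 1) + (j - i - 1) = L := by omega
      simpa [h1, h2] using hp.sink
    · rcases lt_trichotomy k i with h1 | rfl | h1
      · have h2 : k ≤ i := h1.le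
        have h3 : k + 1 ≤ i := h1
        simpa [h2, h3] using hp.step k (by omega)
      · have h2 : k + 1 + (j - k - 1) = j := by omega
        simpa [h2] using hr
      · have h2 : ¬ k ≤ i := by omega
        have h3 : ¬ k + 1 ≤ i := by omega
        have h4 : k + 1 + (j - i - 1) = k + (j - i - 1) + 1 := by omega
        simpa [h2, h3, h4] using hp.step (k + (j - i - 1)) (by omega)
  · refine hlt (L - i) (by omega) (fun k => p (k + i)) ⟨fun k hk => hp.mem _ (by omega),
      by simpa using hs, ?_, fun k hk => ?_⟩
    · have h2 : L - i + i = L := by omega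
      simpa [h2] using hp.sink
    · have h2 : k + 1 + i = k + i + 1 := by omega
      simpa [h2] using hp.step (k + i) (by omega)
  · exact hlt i hi p ⟨fun k hk => hp.mem k (by omega), hp.source, ht,
      fun k hk => hp.step k (by omega)⟩

end Paths

/-! ### Matroid intersection -/

section Intersection

open Set

variable {α : Type*} {M M₁ M₂ : Matroid α} {I J : Set α}

/-- The exchange matrix is triangular: y_i may replace x_i, but y_j may not replace x_i for i < j.
Swapping the first pair keeps the closure and leaves a triangular pattern for the remaining pairs,
so the swaps can be done one at a time. -/
theorem indep_exchange (n : ℕ) (x y : ℕ → α) (hI : M.Indep I) (hx : ∀ i < n, x i ∈ I)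
    (hy : ∀ i < n, y i ∈ M.closure I) (hyI : ∀ i < n, y i ∉ I)
    (h : ∀ i < n, y i ∉ M.closure (I \ {x i}))
    (h' : ∀ i j, i < j → j < n → y j ∈ M.closure (I \ {x i})) :
    M.Indep ((I \ {a | ∃ i < n, x i = a}) ∪ {a | ∃ i < n, y i = a}) ∧
      M.closure ((I \ {a | ∃ i < n, x i = a}) ∪ {a | ∃ i < n, y i = a}) = M.closure I := by
  induction n generalizing I x y with
  | zero => simpa using hI
  | succ n ih =>
    have hx0 := hx 0 (by omega)
    have hne : y 0 ≠ x 0 := fun h => hyI 0 (by omega) (h ▸ hx0)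
    have hxmem : x 0 ∈ M.closure (insert (y 0) (I \ {x 0})) := by
      have h1 : y 0 ∈ M.closure (insert (x 0) (I \ {x 0})) \ M.closure (I \ {x 0}) := by
        refine ⟨?_, h 0 (by omega)⟩
        rw [insert_sdiff_singleton, insert_eq_of_mem hx0]
        exact hy 0 (by omega)
      exact (Matroid.closure_exchange h1).1
    set I' := insert (y 0) (I \ {x 0}) with hI'
    have hsub : I \ {x 0} ⊆ I' := subset_insert _ _
    have hI'i : M.Indep I' := by
      rw [hI', (hI.subset sdiff_subset).insert_indep_iff_of_notMem fun h => hyI 0 (by omega) h.1]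
      exact ⟨M.closure_subset_ground _ (hy 0 (by omega)), h 0 (by omega)⟩
    have hI'c : M.closure I' = M.closure I := by
      apply subset_antisymm <;> apply M.closure_subset_closure_of_subset_closure
      · exact insert_subset (hy 0 (by omega)) (sdiff_subset.trans (M.subset_closure I))
      · intro a ha
        by_cases hax : a = x 0
        · exact hax ▸ hxmem
        · exact M.mem_closure_of_mem (hsub ⟨ha, hax⟩) hI'i.subset_ground
    have hxne : ∀ i < n, x (i + 1) ≠ x 0 := fun i hi he =>
      h (i + 1) (by omega) (he ▸ h' 0 (i + 1) (by omega) (by omega))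
    have hyne : ∀ i < n, y (i + 1) ≠ y 0 := fun i hi he =>
      h 0 (by omega) (he ▸ h' 0 (i + 1) (by omega) (by omega))
    have key := ih (I := I') (fun i => x (i + 1)) (fun i => y (i + 1)) hI'i
      (fun i hi => hsub ⟨hx _ (by omega), hxne i hi⟩)
      (fun i hi => hI'c ▸ hy _ (by omega))
      (fun i hi hm => ?_) (fun i hi hm => ?_) fun i j hij hj => ?_
    · have hset : (I \ {a | ∃ i < n + 1, x i = a}) ∪ {a | ∃ i < n + 1, y i = a} =
          (I' \ {a | ∃ i < n, x (i + 1) = a}) ∪ {a | ∃ i < n, y (i + 1) = a} := by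
        ext a
        simp only [hI', mem_union, mem_sdiff, mem_insert_iff, mem_singleton_iff, mem_ofPred_eq,
          Nat.exists_lt_succ_left]
        have : a = y 0 → ∀ i < n, x (i + 1) ≠ a := fun h i hi he =>
          hyI 0 (by omega) (h ▸ he ▸ hx (i + 1) (by omega))
        grind
      rw [hset, ← hI'c]
      exact key
    · rcases hm with hm | hm
      · exact hyne i hi hm
      · exact hyI _ (by omega) hm.1
    -- Inside the independent set `I'`, closure commutes with intersection. If y_(i+1) were spanned
    -- by I' - x_(i+1) as well as by I - x_0, it would be spanned by their intersection, which lies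
    -- in I - x_(i+1).
    · have hu : M.Indep ((I \ {x 0}) ∪ (I' \ {x (i + 1)})) :=
        hI'i.subset (union_subset hsub sdiff_subset)
      have hm' : y (i + 1) ∈ M.closure ((I \ {x 0}) ∩ (I' \ {x (i + 1)})) := by
        rw [hu.closure_inter_eq_inter_closure]
        exact ⟨h' 0 (i + 1) (by omega) (by omega), hm⟩
      exact h (i + 1) (by omega)
        (M.closure_subset_closure (Y := I \ {x (i + 1)}) (fun a ha => ⟨ha.1.1, ha.2.2⟩) hm')
    -- The same intersection argument, now inside `I`, carries the zeros above the diagonal over to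
    -- `I'`.
    · have hu : M.Indep ((I \ {x 0}) ∪ (I \ {x (i + 1)})) :=
        hI.subset (union_subset sdiff_subset sdiff_subset)
      have hm' : y (j + 1) ∈ M.closure ((I \ {x 0}) ∩ (I \ {x (i + 1)})) := by
        rw [hu.closure_inter_eq_inter_closure]
        exact ⟨h' 0 (j + 1) (by omega) (by omega), h' (i + 1) (j + 1) (by omega) (by omega)⟩
      exact M.closure_subset_closure (Y := I' \ {x (i + 1)})
        (fun a ha => ⟨hsub ha.1, ha.2.2⟩) hm'

/-- Exchange along the whole of a chordless path that starts outside the closure of `I`. -/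
theorem indep_augment (n : ℕ) (x y : ℕ → α) (z : α) (hI : M.Indep I) (hx : ∀ i < n, x i ∈ I)
    (hy : ∀ i < n, y i ∈ M.closure I) (hyI : ∀ i < n, y i ∉ I)
    (h : ∀ i < n, y i ∉ M.closure (I \ {x i}))
    (h' : ∀ i j, i < j → j < n → y j ∈ M.closure (I \ {x i}))
    (hz : z ∈ M.E) (hzI : z ∉ M.closure I) :
    M.Indep (insert z ((I \ {a | ∃ i < n, x i = a}) ∪ {a | ∃ i < n, y i = a})) ∧
      (insert z ((I \ {a | ∃ i < n, x i = a}) ∪ {a | ∃ i < n, y i = a})).encard =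
        I.encard + 1 := by
  obtain ⟨h1, h2⟩ := indep_exchange n x y hI hx hy hyI h h'
  rw [← h2] at hzI
  refine ⟨h1.insert_indep_iff.2 (.inl ⟨hz, hzI⟩), ?_⟩
  -- The exchanged set and `I` are bases of the same flat, hence equally large.
  rw [encard_insert_of_notMem fun h => hzI (M.mem_closure_of_mem h h1.subset_ground),
    h1.isBasis_closure.encard_eq_eRk, h2, ← hI.isBasis_closure.encard_eq_eRk]

/-- The arcs of the exchange graph of a common independent set `I`. -/
def ExchangeArc (M₁ M₂ : Matroid α) (I : Set α) (u v : α) : Prop :=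
  (u ∈ M₂.E \ I ∧ v ∈ I ∧ u ∉ M₂.closure (I \ {v})) ∨
    (u ∈ I ∧ v ∈ M₁.E \ I ∧ v ∉ M₁.closure (I \ {u}))

/-- There is an augmenting path within `W`. -/
def HasAugmentingPath (M₁ M₂ : Matroid α) (I W : Set α) : Prop :=
  HasPath (ExchangeArc M₁ M₂ I) (fun y => y ∈ M₁.E \ M₁.closure I)
    (fun y => y ∈ M₂.E \ M₂.closure I) W

/-- The minimal `W` is a chordless path alternating between the complement of `I` (even positions)
and `I` (odd positions). Arcs out of `I` are exchanges for `M₁`, arcs into `I` are exchanges for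
`M₂`, and the absence of forward chords is the triangularity that `indep_augment` needs. -/
theorem indep_symmDiff (hE : M₁.E = M₂.E) (h₁ : M₁.Indep I) (h₂ : M₂.Indep I) {W : Set α}
    (hW : HasAugmentingPath M₁ M₂ I W) (hmin : ∀ w ∈ W, ¬ HasAugmentingPath M₁ M₂ I (W \ {w})) :
    M₁.Indep (symmDiff I W) ∧ M₂.Indep (symmDiff I W) ∧
      (symmDiff I W).encard = I.encard + 1 := by
  obtain ⟨L, p, hp, rfl, hchord, hsource, hsink⟩ := exists_chordless hW hmin
  have hcl₁ : I ⊆ M₁.closure I := M₁.subset_closure I h₁.subset_ground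
  have hcl₂ : I ⊆ M₂.closure I := M₂.subset_closure I h₂.subset_ground
  have hnotI : ∀ i, 2 * i ≤ L → p (2 * i) ∈ M₁.E \ I ∧ (2 * i + 1 ≤ L → p (2 * i + 1) ∈ I) := by
    have hodd : ∀ i, i + 1 ≤ L → p i ∈ M₁.E \ I → p (i + 1) ∈ I := fun i hi hm => by
      rcases hp.step i hi with h | h
      · exact h.2.1
      · exact absurd h.1 hm.2
    intro i
    induction i with
    | zero =>
      have h0 : p 0 ∈ M₁.E \ I := ⟨hp.source.1, fun h => hp.source.2 (hcl₁ h)⟩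
      exact fun _ => ⟨h0, fun h => hodd 0 h h0⟩
    | succ i ih =>
      intro hi
      have h0 := (ih (by omega)).2 (by omega)
      have h1 : p (2 * (i + 1)) ∈ M₁.E \ I := by
        rcases hp.step (2 * i + 1) (by omega) with h | h
        · exact absurd h0 h.1.2
        · exact h.2.1
      exact ⟨h1, fun h => hodd _ h h1⟩
  -- The last vertex is outside the `M₂`-closure of `I`, hence outside `I`, so its position is even.
  obtain ⟨n, rfl⟩ : ∃ n, L = 2 * n := by
    rcases Nat.even_or_odd' L with ⟨n, h | h⟩
    · exact ⟨n, h⟩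
    · subst h
      exact absurd (hcl₂ ((hnotI n (by omega)).2 le_rfl)) hp.sink.2
  have heven : ∀ i ≤ n, p (2 * i) ∈ M₁.E \ I := fun i hi => (hnotI i (by omega)).1
  have hodd : ∀ i < n, p (2 * i + 1) ∈ I := fun i hi => (hnotI i (by omega)).2 (by omega)
  have hset : symmDiff I {a | ∃ i ≤ 2 * n, p i = a} =
      (I \ {a | ∃ i < n, p (2 * i + 1) = a}) ∪ {a | ∃ i ≤ n, p (2 * i) = a} := by
    ext a
    simp only [mem_symmDiff, mem_ofPred_eq, mem_union, mem_sdiff]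
    refine or_congr (and_congr_right fun ha => not_congr ⟨?_, ?_⟩)
      ⟨?_, fun ⟨i, hi, h⟩ => ⟨⟨_, by omega, h⟩, h ▸ (heven i hi).2⟩⟩
    · rintro ⟨i, hi, rfl⟩
      rcases Nat.even_or_odd' i with ⟨k, rfl | rfl⟩
      · exact absurd ha (heven k (by omega)).2
      · exact ⟨k, by omega, rfl⟩
    · exact fun ⟨i, hi, h⟩ => ⟨_, by omega, h⟩
    · rintro ⟨⟨i, hi, rfl⟩, ha⟩
      rcases Nat.even_or_odd' i with ⟨k, rfl | rfl⟩
      · exact ⟨k, by omega, rfl⟩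
      · exact absurd (hodd k (by omega)) ha
  have hset₁ : symmDiff I {a | ∃ i ≤ 2 * n, p i = a} = insert (p 0)
      ((I \ {a | ∃ i < n, p (2 * i + 1) = a}) ∪ {a | ∃ i < n, p (2 * i + 2) = a}) := by
    rw [hset, ← union_insert]
    congr 1
    ext a
    simp only [mem_ofPred_eq, mem_insert_iff]
    constructor
    · rintro ⟨_ | i, hi, rfl⟩
      · exact .inl rfl
      · exact .inr ⟨i, hi, rfl⟩
    · rintro (rfl | ⟨i, hi, rfl⟩)
      · exact ⟨0, by omega, rfl⟩
      · exact ⟨i + 1, hi, rfl⟩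
  -- For `M₂` the pairs are listed backwards: an arc here goes from the new element to the old one,
  -- so a missing forward chord gives triangularity only in the reversed order.
  have hset₂ : symmDiff I {a | ∃ i ≤ 2 * n, p i = a} = insert (p (2 * n))
      ((I \ {a | ∃ i < n, p (2 * (n - 1 - i) + 1) = a}) ∪
        {a | ∃ i < n, p (2 * (n - 1 - i)) = a}) := by
    have hrev : ∀ q : ℕ → α, {a | ∃ i < n, q (n - 1 - i) = a} = {a | ∃ i < n, q i = a} := by
      intro q
      ext a
      constructor
      · rintro ⟨i, hi, rfl⟩
        exact ⟨_, by omega, rfl⟩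
      · rintro ⟨i, hi, rfl⟩
        exact ⟨n - 1 - i, by omega, congrArg q (by omega)⟩
    rw [hset, ← union_insert, hrev fun i => p (2 * i + 1), hrev fun i => p (2 * i)]
    congr 1
    ext a
    simp only [mem_ofPred_eq, mem_insert_iff]
    constructor
    · rintro ⟨i, hi, rfl⟩
      rcases hi.lt_or_eq with hi | rfl
      · exact .inr ⟨i, hi, rfl⟩
      · exact .inl rfl
    · rintro (rfl | ⟨i, hi, rfl⟩)
      · exact ⟨n, le_rfl, rfl⟩
      · exact ⟨i, hi.le, rfl⟩
  have H₁ := indep_augment (M := M₁) n (fun i => p (2 * i + 1)) (fun i => p (2 * i + 2)) (p 0) h₁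
    hodd ?_ ?_ ?_ ?_ hp.source.1 hp.source.2
  have H₂ := indep_augment (M := M₂) n (fun i => p (2 * (n - 1 - i) + 1))
    (fun i => p (2 * (n - 1 - i))) (p (2 * n)) h₂ (fun i hi => hodd _ (by omega)) ?_ ?_ ?_ ?_
    hp.sink.1 hp.sink.2
  · refine ⟨hset₁ ▸ H₁.1, hset₂ ▸ H₂.1, hset₁ ▸ H₁.2⟩
  · intro i hi
    by_contra hc
    exact hsink (2 * (n - 1 - i)) (by omega) ⟨hE ▸ (heven (n - 1 - i) (by omega)).1, hc⟩
  · exact fun i hi => (heven _ (by omega)).2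
  · intro i hi
    rcases hp.step (2 * (n - 1 - i)) (by omega) with h | h
    · exact h.2.2
    · exact absurd h.1 (heven _ (by omega)).2
  · intro i j hij hj
    by_contra hc
    refine hchord (2 * (n - 1 - j)) (2 * (n - 1 - i) + 1) (by omega) (by omega)
      (.inl ⟨hE ▸ heven _ (by omega), hodd _ (by omega), hc⟩)
  · intro i hi
    by_contra hc
    exact hsource (2 * i + 2) (by omega) (by omega) ⟨(heven (i + 1) (by omega)).1, hc⟩
  · exact fun i hi => (heven (i + 1) (by omega)).2
  · intro i hi
    rcases hp.step (2 * i + 1) (by omega) with h | h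
    · exact absurd (hodd i hi) h.1.2
    · exact h.2.2
  · intro i j hij hj
    by_contra hc
    exact hchord (2 * i + 1) (2 * j + 2) (by omega) (by omega)
      (.inr ⟨hodd _ (by omega), heven (j + 1) (by omega), hc⟩)

/-- I \ U is the intersection of the sets I \ {x} for x in I ∩ U, and closures of subsets of an
independent set commute with intersections. -/
theorem mem_closure_sdiff_of_forall (hI : M.Indep I) {y : α} {U : Set α} (hy : y ∈ M.closure I)
    (h : ∀ x ∈ I ∩ U, y ∈ M.closure (I \ {x})) : y ∈ M.closure (I \ U) := by
  rcases (I ∩ U).eq_empty_or_nonempty with h0 | h0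
  · rwa [sdiff_eq_left.2 (disjoint_iff_inter_eq_empty.2 h0)]
  · have h1 := hI.closure_sInter_eq_biInter_closure_of_forall_subset
      (Js := (fun x => I \ {x}) '' (I ∩ U)) (h0.image _)
      (by rintro _ ⟨x, _, rfl⟩; exact sdiff_subset)
    have h2 : ⋂₀ ((fun x => I \ {x}) '' (I ∩ U)) ⊆ I \ U := by
      intro a ha
      simp only [sInter_image, mem_iInter] at ha
      obtain ⟨b, hb⟩ := h0
      exact ⟨(ha b hb).1, fun haU => (ha a ⟨(ha b hb).1, haU⟩).2 rfl⟩
    refine M.closure_subset_closure h2 (h1.ge ?_)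
    simpa using h

theorem encard_le_of_subset_closure {A B : Set α} (hA : M.Indep A) (hAB : A ⊆ M.closure B) :
    A.encard ≤ B.encard :=
  (hA.encard_le_eRk_of_subset hAB).trans
    ((Matroid.eRk_closure_eq _ _).le.trans (Matroid.eRk_le_encard _ _))

/-- The easy half of the min-max formula: |J| is at most the `M₁`-rank of E \ U plus the `M₂`-rank
of E ∩ U. No exchange arc leaves the reachable set U, so I \ U and I ∩ U span these two sets and the
sum is at most |I|. -/
theorem encard_le_of_not_hasAugmentingPath (hE : M₁.E = M₂.E) (h₁ : M₁.Indep I) (h₂ : M₂.Indep I)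
    (h : ¬ HasAugmentingPath M₁ M₂ I univ) (hJ₁ : M₁.Indep J) (hJ₂ : M₂.Indep J) :
    J.encard ≤ I.encard := by
  set U : Set α := {b | ∃ a, a ∈ M₁.E \ M₁.closure I ∧
    Relation.ReflTransGen (ExchangeArc M₁ M₂ I) a b}
  have hU : ∀ u ∈ U, ∀ v, ExchangeArc M₁ M₂ I u v → v ∈ U := by
    rintro u ⟨a, ha, hau⟩ v huv
    exact ⟨a, ha, hau.tail huv⟩
  have hsink : ∀ b ∈ U, b ∈ M₂.E → b ∈ M₂.closure I := by
    rintro b ⟨a, ha, hab⟩ hb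
    by_contra hc
    exact h ⟨a, mem_univ _, b, mem_univ _, ha, ⟨hb, hc⟩, by simpa using hab⟩
  have hin : M₂.E ∩ U ⊆ M₂.closure (I ∩ U) := by
    rintro y ⟨hyE, hyU⟩
    by_cases hyI : y ∈ I
    · exact M₂.mem_closure_of_mem' ⟨hyI, hyU⟩
    · have := mem_closure_sdiff_of_forall h₂ (U := Uᶜ) (hsink y hyU hyE) fun x hx => by
        by_contra hc
        exact hx.2 (hU y hyU x (.inl ⟨⟨hyE, hyI⟩, hx.1, hc⟩))
      simpa [sdiff_eq] using this
  have hout : M₁.E \ U ⊆ M₁.closure (I \ U) := by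
    rintro y ⟨hyE, hyU⟩
    by_cases hyI : y ∈ I
    · exact M₁.mem_closure_of_mem' ⟨hyI, hyU⟩
    · refine mem_closure_sdiff_of_forall h₁ ?_ fun x hx => ?_
      · by_contra hc
        exact hyU ⟨y, ⟨hyE, hc⟩, .refl⟩
      · by_contra hc
        exact hyU (hU x hx.2 y (.inr ⟨hx.1, ⟨hyE, hyI⟩, hc⟩))
  rw [← encard_sdiff_add_encard_inter J U, ← encard_sdiff_add_encard_inter I U]
  refine add_le_add (encard_le_of_subset_closure (hJ₁.subset sdiff_subset) ?_)
    (encard_le_of_subset_closure (hJ₂.subset inter_subset_left) ?_)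
  · exact (sdiff_subset_sdiff_left hJ₁.subset_ground).trans hout
  · exact (inter_subset_inter_left _ hJ₂.subset_ground).trans hin

end Intersection


/-! ### Graphic matroids -/

section Graphic

open Set Submodule

variable {α W : Type*} {ends : α → Sym2 W} {X Y : Set α}

/-- The column of an edge in the incidence matrix over the field with two elements. -/
noncomputable def incidence : Sym2 W → W →₀ ZMod 2 :=
  Sym2.lift ⟨fun x y => Finsupp.single x 1 + Finsupp.single y 1, fun _ _ => add_comm _ _⟩

/-- The columns along a walk telescope to the column of its two ends. Conversely, the indicator of a
component is a functional separating the column of a disconnected pair from the span. -/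
theorem incidence_mem_span_iff {A : Set (Sym2 W)} {x y : W} :
    incidence s(x, y) ∈ span (ZMod 2) (incidence '' A) ↔
      (SimpleGraph.fromEdgeSet A).Reachable x y := by
  classical
  have hself : ∀ v : W, (Finsupp.single v 1 : W →₀ ZMod 2) + Finsupp.single v 1 = 0 := fun v => by
    rw [← Finsupp.single_add, CharTwo.add_self_eq_zero, Finsupp.single_zero]
  have hadd : ∀ u v w : W, incidence s(u, v) + incidence s(v, w) = incidence s(u, w) := by
    intro u v w
    simp only [incidence, Sym2.lift_mk]
    rw [add_assoc, ← add_assoc (Finsupp.single v 1), hself, zero_add]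
  constructor
  · intro h
    by_contra hxy
    let c : W → ZMod 2 := fun w => if (SimpleGraph.fromEdgeSet A).Reachable x w then 1 else 0
    have hc : ∀ u v, Finsupp.linearCombination (ZMod 2) c (incidence s(u, v)) = c u + c v := by
      intro u v
      simp [incidence]
    have hle : span (ZMod 2) (incidence '' A) ≤
        LinearMap.ker (Finsupp.linearCombination (ZMod 2) c) := by
      rw [span_le]
      rintro _ ⟨e, he, rfl⟩
      induction e with
      | h u v =>
        rw [SetLike.mem_coe, LinearMap.mem_ker, hc]
        have huv : (SimpleGraph.fromEdgeSet A).Reachable u v := by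
          rw [SimpleGraph.reachable_fromEdgeSet_eq_reflTransGen_toRel]
          exact .single he
        have : c u = c v := by
          simp only [c]
          exact if_congr ⟨fun h => h.trans huv, fun h => h.trans huv.symm⟩ rfl rfl
        rw [this]
        exact CharTwo.add_self_eq_zero _
    have h0 := LinearMap.mem_ker.1 (hle h)
    rw [hc] at h0
    simp [c, hxy] at h0
  · rw [SimpleGraph.reachable_fromEdgeSet_eq_reflTransGen_toRel]
    intro h
    induction h with
    | refl =>
      have : incidence s(x, x) = 0 := hself x
      rw [this]
      exact zero_mem _
    | tail _ h ih =>
      rw [← hadd]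
      exact add_mem ih (subset_span ⟨_, h, rfl⟩)

/-- The matroid axioms for forests thereby reduce to linear algebra; loops are covered because their
column is zero. -/
theorem isForest_iff_linearIndepOn :
    IsForest ends X ↔ LinearIndepOn (ZMod 2) (fun e => incidence (ends e)) X := by
  rw [linearIndepOn_iff_notMem_span, IsForest]
  refine forall₂_congr fun e _ => ?_
  rw [← image_image (g := incidence) (f := ends)]
  constructor
  · intro h
    induction he : ends e with
    | h x y => exact fun hm => h x y he (incidence_mem_span_iff.1 hm)
  · intro h x y he hr
    exact h (he ▸ incidence_mem_span_iff.2 hr)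

theorem isForest_insert_iff {e : α} {x y : W} (he : ends e = s(x, y)) (heX : e ∉ X) :
    IsForest ends (insert e X) ↔ IsForest ends X ∧
      ¬ (SimpleGraph.fromEdgeSet (ends '' X)).Reachable x y := by
  rw [isForest_iff_linearIndepOn, linearIndepOn_insert heX, isForest_iff_linearIndepOn, he,
    ← incidence_mem_span_iff, image_image]

theorem IsForest.subset (h : IsForest ends Y) (hXY : X ⊆ Y) : IsForest ends X :=
  isForest_iff_linearIndepOn.2 ((isForest_iff_linearIndepOn.1 h).mono hXY)

theorem IsForest.augment (hX : IsForest ends X) (hY : IsForest ends Y) (hYf : Y.Finite)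
    (hXf : X.Finite) (hlt : X.ncard < Y.ncard) : ∃ e ∈ Y, e ∉ X ∧ IsForest ends (insert e X) := by
  rw [isForest_iff_linearIndepOn] at hX hY
  simp only [isForest_iff_linearIndepOn]
  by_contra! hcon
  have hsub : span (ZMod 2) ((fun e => incidence (ends e)) '' Y) ≤
      span (ZMod 2) ((fun e => incidence (ends e)) '' X) := by
    rw [span_le]
    rintro _ ⟨e, he, rfl⟩
    by_cases heX : e ∈ X
    · exact subset_span ⟨e, heX, rfl⟩
    · by_contra hm
      exact hcon e he heX (hX.insert hm)
  have := hXf.fintype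
  have := hYf.fintype
  have hX' := finrank_span_eq_card hX
  have hY' := finrank_span_eq_card hY
  have hfin : FiniteDimensional (ZMod 2) (span (ZMod 2) ((fun e => incidence (ends e)) '' X)) :=
    FiniteDimensional.span_of_finite _ (hXf.image _)
  have hle := Submodule.finrank_mono hsub
  rw [image_eq_range, image_eq_range] at hle
  erw [hX', hY', ← Nat.card_eq_fintype_card, ← Nat.card_eq_fintype_card, Nat.card_coe_set_eq,
    Nat.card_coe_set_eq] at hle
  omega

/-- The graphic matroid of the multigraph with the ends `ends`, restricted to the edges in `E`. -/
def graphicMatroid (ends : α → Sym2 W) {E : Set α} (hE : E.Finite) : Matroid α :=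
  (IndepMatroid.ofFinite hE (fun X => X ⊆ E ∧ IsForest ends X)
    ⟨empty_subset _, fun _ h => h.elim⟩ (fun _ _ h hs => ⟨hs.trans h.1, h.2.subset hs⟩)
    (fun _ _ hI hJ hlt => by
      obtain ⟨e, heJ, heI, h⟩ := hI.2.augment hJ.2 (hE.subset hJ.1) (hE.subset hI.1) hlt
      exact ⟨e, heJ, heI, insert_subset (hJ.1 heJ) hI.1, h⟩)
    (fun _ h => h.1)).matroid

theorem graphicMatroid_ground {E : Set α} (hE : E.Finite) : (graphicMatroid ends hE).E = E := rfl

theorem graphicMatroid_indep {E : Set α} (hE : E.Finite) :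
    (graphicMatroid ends hE).Indep X ↔ X ⊆ E ∧ IsForest ends X := Iff.rfl

/-- Turns matroid closure into a connectivity question, which the machine can answer. -/
theorem mem_closure_graphicMatroid {E : Set α} (hE : E.Finite)
    (hX : (graphicMatroid ends hE).Indep X) {e : α} (he : e ∈ E) {x y : W}
    (hxy : ends e = s(x, y)) : e ∈ (graphicMatroid ends hE).closure X ↔
      (SimpleGraph.fromEdgeSet (ends '' X)).Reachable x y := by
  by_cases heX : e ∈ X
  · refine iff_of_true (Matroid.mem_closure_of_mem _ heX hX.subset_ground) ?_
    rw [SimpleGraph.reachable_fromEdgeSet_eq_reflTransGen_toRel]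
    exact .single ⟨e, heX, hxy⟩
  · rw [hX.mem_closure_iff']
    have := isForest_insert_iff hxy heX
    simp only [graphicMatroid_ground, graphicMatroid_indep, insert_subset_iff] at *
    tauto

/-- Passing to a simple graph merges parallel edges and drops loops, so both are excluded by
hypothesis. -/
theorem isForest_iff_isAcyclic (hinj : InjOn ends X) (hdiag : ∀ e ∈ X, ¬ (ends e).IsDiag) :
    IsForest ends X ↔ (SimpleGraph.fromEdgeSet (ends '' X)).IsAcyclic := by
  rw [SimpleGraph.isAcyclic_iff_forall_adj_isBridge]
  constructor
  · intro h x y hxy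
    obtain ⟨e, he, hex⟩ := ((SimpleGraph.fromEdgeSet_adj _).1 hxy).1
    rw [SimpleGraph.isBridge_iff]
    intro hr
    refine h e he x y hex (hr.mono ?_)
    intro u v huv
    rw [SimpleGraph.deleteEdges_adj, SimpleGraph.fromEdgeSet_adj] at huv
    obtain ⟨⟨⟨f, hf, hfu⟩, hne⟩, hn⟩ := huv
    refine (SimpleGraph.fromEdgeSet_adj _).2 ⟨⟨f, ⟨hf, ?_⟩, hfu⟩, hne⟩
    rintro rfl
    exact hn (by rw [← hfu, hex]; rfl)
  · intro h e he x y hxy hr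
    have hne : x ≠ y := fun hne => hdiag e he (by rw [hxy]; exact hne)
    have hb := SimpleGraph.isBridge_iff.1 (h
      ((SimpleGraph.fromEdgeSet_adj _).2 ⟨⟨e, he, hxy⟩, hne⟩))
    refine hb (hr.mono ?_)
    intro u v huv
    obtain ⟨⟨f, hf, hfu⟩, hne⟩ := (SimpleGraph.fromEdgeSet_adj _).1 huv
    rw [SimpleGraph.deleteEdges_adj, SimpleGraph.fromEdgeSet_adj]
    refine ⟨⟨⟨f, hf.1, hfu⟩, hne⟩, fun hm => hf.2 (hinj hf.1 he ?_)⟩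
    rw [hfu, hxy]
    exact hm

/-- A forest is spanning if and only if its number of edges is one less than the number of
vertices. -/
theorem IsForest.connected_iff [Finite W] (h : IsForest ends X) :
    (SimpleGraph.fromEdgeSet (ends '' X)).Connected ↔ X.ncard + 1 = Nat.card W := by
  have hinj : InjOn ends X := by
    intro e he f hf hef
    by_contra hne
    induction hx : ends e with
    | h x y =>
      refine h e he x y hx ?_
      rw [SimpleGraph.reachable_fromEdgeSet_eq_reflTransGen_toRel]
      exact .single ⟨f, ⟨hf, fun h => hne h.symm⟩, hef ▸ hx⟩
  have hdiag : ∀ e ∈ X, ¬ (ends e).IsDiag := by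
    intro e he hd
    induction hx : ends e with
    | h x y =>
      rw [hx] at hd
      obtain rfl : x = y := by simpa using hd
      exact h e he x x hx .rfl
  have hset : (SimpleGraph.fromEdgeSet (ends '' X)).edgeSet = ends '' X := by
    rw [SimpleGraph.edgeSet_fromEdgeSet, sdiff_eq_left, disjoint_left]
    rintro _ ⟨e, he, rfl⟩
    exact hdiag e he
  have hacyc := (isForest_iff_isAcyclic hinj hdiag).1 h
  have hcard : Nat.card (SimpleGraph.fromEdgeSet (ends '' X)).edgeSet = X.ncard := by
    rw [hset, Nat.card_coe_set_eq, hinj.ncard_image]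
  constructor
  · intro hc
    rw [← hcard]
    exact (SimpleGraph.isTree_iff_connected_and_card.1 ⟨hc, hacyc⟩).2
  · intro hX
    have : Nonempty W := (Nat.card_pos_iff.1 (by omega)).1
    -- A spanning tree containing the forest has |W| - 1 = |X| edges and therefore equals it.
    obtain ⟨T, hT, -, htree⟩ :=
      (SimpleGraph.connected_top (V := W)).exists_isTree_le_of_le_of_isAcyclic le_top hacyc
    have hTc := (SimpleGraph.isTree_iff_connected_and_card.1 htree).2
    have hTe : (SimpleGraph.fromEdgeSet (ends '' X)).edgeSet = T.edgeSet := by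
      refine Set.eq_of_subset_of_ncard_le (SimpleGraph.edgeSet_mono hT) ?_ (toFinite _)
      rw [← Nat.card_coe_set_eq, ← Nat.card_coe_set_eq]
      omega
    rw [SimpleGraph.edgeSet_inj.1 hTe]
    exact htree.connected

end Graphic


/-! ### Feasibility and matroid intersection -/

section Feasibility

open Set

variable {V : Type*} {G : SimpleGraph V} {D : Digraph G.edgeSet} {X Y : Set G.edgeSet}

/-- Arcs with a common vertex lie in one component, which carries only one arc. This gives
uniqueness of the dependency, injectivity of the dependency map, and the fact that dependencies have
no dependencies. -/
theorem ComponentsArePathsOfLengthLEOne.eq_of_adj {E : Type*} {D : Digraph E}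
    (hD : ComponentsArePathsOfLengthLEOne D) {a b x y : E} (hab : D.Adj a b) (hxy : D.Adj x y)
    (h : x = a ∨ x = b ∨ y = a ∨ y = b) : x = a ∧ y = b := by
  have key : ∀ {u v}, D.Adj u v → D.toSimpleGraphInclusive.connectedComponentMk u =
      D.toSimpleGraphInclusive.connectedComponentMk v := by
    intro u v huv
    by_cases he : u = v
    · rw [he]
    · exact SimpleGraph.ConnectedComponent.sound
        (SimpleGraph.Adj.reachable ⟨he, Or.inl huv⟩)
  set c := D.toSimpleGraphInclusive.connectedComponentMk a with hc
  have ha : a ∈ c.supp := rfl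
  have hb : b ∈ c.supp := (key hab).symm
  have hx : x ∈ c.supp := by
    rcases h with rfl | rfl | rfl | rfl
    · exact ha
    · exact hb
    · exact key hxy
    · exact (key hxy).trans hb
  have hy : y ∈ c.supp := (key hxy).symm.trans hx
  rcases hD c with ⟨e, hs, he⟩ | ⟨e, f, -, -, he⟩
  · rw [hs] at ha hb
    obtain rfl : a = e := ha
    obtain rfl : b = a := hb
    exact absurd hab he
  · obtain ⟨rfl, rfl⟩ := (he a ha b hb).1 hab
    exact (he x hx y hy).1 hxy

theorem ComponentsArePathsOfLengthLEOne.not_adj_self {E : Type*} {D : Digraph E}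
    (hD : ComponentsArePathsOfLengthLEOne D) (a : E) : ¬ D.Adj a a := by
  intro h
  have ha : a ∈ (D.toSimpleGraphInclusive.connectedComponentMk a).supp := rfl
  rcases hD (D.toSimpleGraphInclusive.connectedComponentMk a) with ⟨e, hs, he⟩ | ⟨e, f, hef, -, he⟩
  · rw [hs] at ha
    obtain rfl : a = e := ha
    exact he h
  · obtain ⟨rfl, rfl⟩ := (he a ha a ha).1 h
    exact hef rfl

/-- The ends of the dependency of an edge. -/
noncomputable def depEnds (D : Digraph G.edgeSet) (e : G.edgeSet) : Sym2 V :=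
  open Classical in if h : (dep D e).Nonempty then h.some else e

theorem depEnds_eq (hD : ComponentsArePathsOfLengthLEOne D) {e f : G.edgeSet} (hf : f ∈ dep D e) :
    depEnds D e = f := by
  have h : (dep D e).Nonempty := ⟨f, hf⟩
  rw [depEnds, dif_pos h]
  exact congrArg _ (hD.eq_of_adj hf h.some_mem (by simp)).1

theorem image_depEnds (hD : ComponentsArePathsOfLengthLEOne D) (hX : X ⊆ dependentEdges D) :
    depEnds D '' X = Subtype.val '' depSet D X := by
  ext z
  simp only [mem_image, depSet, mem_iUnion]
  constructor
  · rintro ⟨e, he, rfl⟩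
    obtain ⟨f, hf⟩ := hX he
    exact ⟨f, ⟨e, he, hf⟩, (depEnds_eq hD hf).symm⟩
  · rintro ⟨f, ⟨e, he, hf⟩, rfl⟩
    exact ⟨e, he, depEnds_eq hD hf⟩

theorem isForest_depEnds_iff (hD : ComponentsArePathsOfLengthLEOne D)
    (hX : X ⊆ dependentEdges D) : IsForest (depEnds D) X ↔
      (SimpleGraph.fromEdgeSet (Subtype.val '' depSet D X)).IsAcyclic := by
  rw [← image_depEnds hD hX]
  refine isForest_iff_isAcyclic ?_ ?_
  · intro e he e' he' h
    obtain ⟨f, hf⟩ := hX he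
    obtain ⟨f', hf'⟩ := hX he'
    rw [depEnds_eq hD hf, depEnds_eq hD hf'] at h
    obtain rfl := Subtype.ext h
    exact (hD.eq_of_adj hf' hf (by simp)).2
  · intro e he
    obtain ⟨f, hf⟩ := hX he
    rw [depEnds_eq hD hf]
    exact SimpleGraph.not_isDiag_of_mem_edgeSet _ f.2

/-- A subset of the finite set dep(e) with |dep(e)| elements is all of it. -/
theorem satisfies_iff [Finite V] {ℓ u : G.edgeSet → ℕ} (h : ∀ e, ℓ e = u e ∧ u e = (dep D e).ncard)
    {T : SimpleGraph V} : Satisfies D ℓ u T ↔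
      ∀ e : G.edgeSet, (e : Sym2 V) ∈ T.edgeSet → ∀ f ∈ dep D e, (f : Sym2 V) ∈ T.edgeSet := by
  refine forall₂_congr fun e _ => ?_
  rw [(h e).1, (h e).2]
  constructor
  · intro h
    exact inter_eq_left.1 (eq_of_subset_of_ncard_le inter_subset_left h.1)
  · intro h
    rw [inter_eq_left.2 (show dep D e ⊆ {e' | (e' : Sym2 V) ∈ T.edgeSet} from h)]
    exact ⟨le_rfl, le_rfl⟩

theorem baseGraph_adj {x y : V} : (baseGraph D).Adj x y ↔
    ∃ h : G.Adj x y, ¬ (dep D ⟨s(x, y), h⟩).Nonempty := by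
  simp only [baseGraph, SimpleGraph.deleteEdges_adj, mem_image, Subtype.exists, dependentEdges,
    mem_ofPred_eq]
  constructor
  · rintro ⟨h, h'⟩
    exact ⟨h, fun hn => h' ⟨s(x, y), h, hn, rfl⟩⟩
  · rintro ⟨h, h'⟩
    refine ⟨h, ?_⟩
    rintro ⟨_, _, hn, rfl⟩
    exact h' hn

/-- From a tree, take its edges in S. From X, the forest dep(X) must first be secured inside the
tree; the connections still missing are supplied by X. -/
theorem gdcst_iff [Finite V] (hD : ComponentsArePathsOfLengthLEOne D) {ℓ u : G.edgeSet → ℕ}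
    (h : ∀ e, ℓ e = u e ∧ u e = (dep D e).ncard) : GDCST D ℓ u ↔
      ∃ X ⊆ dependentEdges D, (SimpleGraph.fromEdgeSet (Subtype.val '' depSet D X)).IsAcyclic ∧
        (baseGraph D ⊔ SimpleGraph.fromEdgeSet (Subtype.val '' X)).Connected := by
  constructor
  · rintro ⟨T, hTG, hT, hsat⟩
    rw [satisfies_iff h] at hsat
    refine ⟨{e | e ∈ dependentEdges D ∧ (e : Sym2 V) ∈ T.edgeSet}, fun e he => he.1,
      hT.isAcyclic.anti ?_, hT.connected.mono ?_⟩
    · intro x y hxy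
      obtain ⟨⟨f, hf, hfxy⟩, -⟩ := (SimpleGraph.fromEdgeSet_adj _).1 hxy
      simp only [depSet, mem_iUnion] at hf
      obtain ⟨e, he, hf⟩ := hf
      have := hsat e he.2 f hf
      rwa [hfxy] at this
    · intro x y hxy
      rw [SimpleGraph.sup_adj, baseGraph_adj, SimpleGraph.fromEdgeSet_adj]
      by_cases hn : (dep D ⟨s(x, y), hTG hxy⟩).Nonempty
      · exact .inr ⟨⟨_, ⟨hn, hxy⟩, rfl⟩, hxy.ne⟩
      · exact .inl ⟨hTG hxy, hn⟩
  · rintro ⟨X, hXS, hac, hc⟩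
    -- A dependency is the tail of an arc and so never the head of one: it lies in G - S.
    have hle : SimpleGraph.fromEdgeSet (Subtype.val '' depSet D X) ≤ baseGraph D := by
      intro x y hxy
      obtain ⟨⟨f, hf, hfxy⟩, -⟩ := (SimpleGraph.fromEdgeSet_adj _).1 hxy
      simp only [depSet, mem_iUnion] at hf
      obtain ⟨e, he, hf⟩ := hf
      have hG : G.Adj x y := by
        rw [← SimpleGraph.mem_edgeSet, ← hfxy]
        exact f.2
      have hfe : f = ⟨s(x, y), hG⟩ := Subtype.ext hfxy
      refine baseGraph_adj.2 ⟨hG, ?_⟩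
      rintro ⟨g, hg⟩
      have hg' : D.Adj g f := by
        rw [hfe]
        exact hg
      have hgf := (hD.eq_of_adj hf hg' (by simp)).1
      rw [hgf] at hg'
      exact hD.not_adj_self _ hg'
    obtain ⟨F, hF0, hFle, hFac, hFr⟩ :=
      (baseGraph D).exists_isAcyclic_reachable_eq_le_of_le_of_isAcyclic hle hac
    -- The forest `F` connects the same vertices as G - S and may replace it.
    have hconn : (F ⊔ SimpleGraph.fromEdgeSet (Subtype.val '' X)).Connected := by
      have := hc.nonempty
      refine ⟨fun x y => ?_⟩
      have hxy := hc.preconnected x y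
      rw [SimpleGraph.reachable_iff_reflTransGen] at hxy
      induction hxy with
      | refl => exact .rfl
      | tail _ h ih =>
        refine ih.trans ?_
        rcases h with h | h
        · have hr := h.reachable
          rw [← hFr] at hr
          exact hr.mono le_sup_left
        · exact h.reachable.mono le_sup_right
    -- The tree contains `F`, hence dep(X), but need not use all of X.
    obtain ⟨T, hFT, hTle, hT⟩ := hconn.exists_isTree_le_of_le_of_isAcyclic le_sup_left hFac
    refine ⟨T, hTle.trans (sup_le (hFle.trans (SimpleGraph.deleteEdges_le _)) ?_), hT,
      (satisfies_iff h).2 fun e he f hf => ?_⟩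
    · intro x y hxy
      obtain ⟨⟨f, -, hfxy⟩, -⟩ := (SimpleGraph.fromEdgeSet_adj _).1 hxy
      rw [← SimpleGraph.mem_edgeSet, ← hfxy]
      exact f.2
    -- An edge with a dependency cannot belong to `F`, which lies in G - S, so it comes from X.
    · have heX : e ∈ X := by
        obtain ⟨e, heG⟩ := e
        induction e with
        | h x y =>
          rcases hTle he with h | h
          · exact absurd ⟨f, hf⟩ (baseGraph_adj.1 (hFle h)).2
          · obtain ⟨⟨f, hf, hfxy⟩, -⟩ := (SimpleGraph.fromEdgeSet_adj _).1 h
            exact (Subtype.ext hfxy : f = ⟨s(x, y), heG⟩) ▸ hf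
      refine SimpleGraph.edgeSet_mono (hF0.trans hFT) ?_
      rw [SimpleGraph.edgeSet_fromEdgeSet]
      refine ⟨⟨f, ?_, rfl⟩, SimpleGraph.not_isDiag_of_mem_edgeSet _ f.2⟩
      simp only [depSet, mem_iUnion]
      exact ⟨e, heX, hf⟩

/-- A walk in the contracted graph lifts once consecutive edges are linked by walks inside a
component of G - S. -/
theorem reachable_contractedEnds_iff {x y : V} :
    (SimpleGraph.fromEdgeSet (contractedEnds D '' X)).Reachable
      ((baseGraph D).connectedComponentMk x) ((baseGraph D).connectedComponentMk y) ↔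
    (baseGraph D ⊔ SimpleGraph.fromEdgeSet (Subtype.val '' X)).Reachable x y := by
  constructor
  · intro h
    rw [SimpleGraph.reachable_fromEdgeSet_eq_reflTransGen_toRel] at h
    generalize hc : (baseGraph D).connectedComponentMk y = c at h
    induction h generalizing y with
    | refl => exact (SimpleGraph.ConnectedComponent.exact hc.symm).mono le_sup_left
    | @tail c₁ c₂ _ h ih =>
      obtain ⟨e, he, hez⟩ := h
      have key : ∀ u v, (e : Sym2 V) = s(u, v) → (baseGraph D).connectedComponentMk v = c₂ →
          (baseGraph D ⊔ SimpleGraph.fromEdgeSet (Subtype.val '' X)).Reachable x u →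
          (baseGraph D ⊔ SimpleGraph.fromEdgeSet (Subtype.val '' X)).Reachable x y := by
        intro u v huv hv hxu
        have h1 : (SimpleGraph.fromEdgeSet (Subtype.val '' X)).Reachable u v := by
          rw [SimpleGraph.reachable_fromEdgeSet_eq_reflTransGen_toRel]
          exact .single ⟨e, he, huv⟩
        exact (hxu.trans (h1.mono le_sup_right)).trans
          ((SimpleGraph.ConnectedComponent.exact (hv.trans hc.symm)).mono le_sup_left)
      rw [contractedEnds] at hez
      induction huv : (e : Sym2 V) with
      | h u v =>
        rw [huv, Sym2.map_mk, Sym2.eq_iff] at hez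
        rcases hez with ⟨h1, h2⟩ | ⟨h1, h2⟩
        · exact key u v huv h2 (ih h1)
        · exact key v u (huv.trans Sym2.eq_swap) h1 (ih h2)
  · intro h
    rw [SimpleGraph.reachable_iff_reflTransGen] at h
    induction h with
    | refl => exact .rfl
    | tail _ h ih =>
      refine ih.trans ?_
      rcases h with h | h
      · rw [SimpleGraph.ConnectedComponent.sound h.reachable]
      · obtain ⟨⟨f, hf, hfxy⟩, -⟩ := (SimpleGraph.fromEdgeSet_adj _).1 h
        rw [SimpleGraph.reachable_fromEdgeSet_eq_reflTransGen_toRel]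
        exact .single ⟨f, hf, by rw [contractedEnds, hfxy]; rfl⟩

theorem connected_contractedEnds_iff :
    (SimpleGraph.fromEdgeSet (contractedEnds D '' X)).Connected ↔
    (baseGraph D ⊔ SimpleGraph.fromEdgeSet (Subtype.val '' X)).Connected := by
  rw [SimpleGraph.connected_iff, SimpleGraph.connected_iff]
  refine and_congr ⟨fun h x y => reachable_contractedEnds_iff.1 (h _ _), fun h c c' => ?_⟩
    ⟨fun ⟨c⟩ => c.ind fun v => ⟨v⟩, fun ⟨v⟩ => ⟨(baseGraph D).connectedComponentMk v⟩⟩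
  induction c using SimpleGraph.ConnectedComponent.ind with
  | h x =>
    induction c' using SimpleGraph.ConnectedComponent.ind with
    | h y => exact reachable_contractedEnds_iff.2 (h x y)

variable [Finite V]

/-- The graphic matroid of the graph of the dependencies. -/
noncomputable def depMatroid (D : Digraph G.edgeSet) : Matroid G.edgeSet :=
  graphicMatroid (depEnds D) (toFinite (dependentEdges D))

/-- The graphic matroid of the graph in which the components of `G - S` are contracted. -/
noncomputable def contractedMatroid (D : Digraph G.edgeSet) : Matroid G.edgeSet :=
  graphicMatroid (contractedEnds D) (toFinite (dependentEdges D))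

/-- Shrinking X to a basis of it in the second matroid keeps H connected, and a spanning forest has
k - 1 edges. The form `X.ncard + 1` also treats the empty graph correctly: then k = 0, and neither
side holds. -/
theorem gdcst_iff_exists_indep (hD : ComponentsArePathsOfLengthLEOne D) {ℓ u : G.edgeSet → ℕ}
    (h : ∀ e, ℓ e = u e ∧ u e = (dep D e).ncard) : GDCST D ℓ u ↔
      ∃ X, (depMatroid D).Indep X ∧ (contractedMatroid D).Indep X ∧
        X.ncard + 1 = Nat.card (baseGraph D).ConnectedComponent := by
  rw [gdcst_iff hD h]
  constructor
  · rintro ⟨X, hXS, hac, hc⟩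
    obtain ⟨Y, hY⟩ := (contractedMatroid D).exists_isBasis X hXS
    have hXi : (depMatroid D).Indep X := ⟨hXS, (isForest_depEnds_iff hD hXS).2 hac⟩
    refine ⟨Y, hXi.subset hY.subset, hY.indep, (IsForest.connected_iff hY.indep.2).1 ?_⟩
    rw [← connected_contractedEnds_iff] at hc
    have := hc.nonempty
    refine ⟨fun x y => ?_⟩
    have hxy := hc.preconnected x y
    rw [SimpleGraph.reachable_fromEdgeSet_eq_reflTransGen_toRel] at hxy
    induction hxy with
    | refl => exact .rfl
    | tail _ h ih =>
      obtain ⟨e, he, hez⟩ := h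
      exact ih.trans ((mem_closure_graphicMatroid _ hY.indep (hXS he) hez).1
        (hY.subset_closure he))
  · rintro ⟨X, h1, h2, h3⟩
    exact ⟨X, h1.1, (isForest_depEnds_iff hD h1.1).1 h1.2,
      connected_contractedEnds_iff.1 ((IsForest.connected_iff h2.2).2 h3)⟩

end Feasibility


/-! ### The algorithm -/

section Algorithm

/-- Edge `i` has a dependency. -/
def Instance.IsDependent (I : Instance) (i : ℕ) : Prop :=
  ∃ k < I.r, toArray I.head k = i

/-- The vertices `u` and `v` are joined by an edge whose position in the list satisfies `A`. -/
def Instance.EdgeAdj (I : Instance) (A : ℕ → Prop) (u v : ℕ) : Prop :=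
  ∃ i < I.m, A i ∧ ((toArray I.fst i = u ∧ toArray I.snd i = v) ∨
    (toArray I.fst i = v ∧ toArray I.snd i = u))

/-- The vertices `u` and `v` are connected by the edges whose positions satisfy `A`. -/
def Instance.Conn (I : Instance) (A : ℕ → Prop) (u v : ℕ) : Prop :=
  Reach I.size (I.EdgeAdj A) u v

/-- The dependencies of the edges in `A` connect the ends of the dependency of the edge `y`. -/
def Instance.DepSpans (I : Instance) (A : ℕ → Prop) (y : ℕ) : Prop :=
  ∃ k < I.r, toArray I.head k = y ∧
    I.Conn (fun i => ∃ k < I.r, toArray I.tail k = i ∧ A (toArray I.head k))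
      (toArray I.fst (toArray I.tail k)) (toArray I.snd (toArray I.tail k))

/-- The edges in `A` and those without a dependency connect the ends of the edge `y`. -/
def Instance.BaseSpans (I : Instance) (A : ℕ → Prop) (y : ℕ) : Prop :=
  I.Conn (fun i => ¬ I.IsDependent i ∨ A i) (toArray I.fst y) (toArray I.snd y)

/-- The arcs of the exchange graph of `X`. -/
def Instance.Arc (I : Instance) (X : Set ℕ) (u v : ℕ) : Prop :=
  ((I.IsDependent u ∧ u ∉ X) ∧ v ∈ X ∧ ¬ I.BaseSpans (fun i => i ∈ X ∧ i ≠ v) u) ∨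
    (u ∈ X ∧ (I.IsDependent v ∧ v ∉ X) ∧ ¬ I.DepSpans (fun i => i ∈ X ∧ i ≠ u) v)

/-- The exchange graph of `X` has an augmenting path with all vertices in `W`. -/
def Instance.HasAug (I : Instance) (X : Set ℕ) (W : ℕ → Prop) : Prop :=
  ∃ a < I.size, ∃ b < I.size, (W a ∧ W b) ∧
    ((I.IsDependent a ∧ ¬ I.DepSpans (fun i => i ∈ X) a) ∧
      (I.IsDependent b ∧ ¬ I.BaseSpans (fun i => i ∈ X) b)) ∧
    Reach I.size (fun u v => (W u ∧ W v) ∧ I.Arc X u v) a b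

/-- The numbers that are not on the chosen augmenting path. -/
def Instance.removed (I : Instance) (X : Set ℕ) : Set ℕ :=
  -- Round `t` discards `t` if an augmenting path survives without it. A single pass suffices, since
  -- a number that cannot be spared now cannot be spared after further removals.
  stage (fun Z t i => i ∈ Z ∨ (i = t ∧ I.HasAug X fun j => j ∉ Z ∧ j ≠ t)) I.size I.size

/-- Augment `X` along the chosen path, if there is one. -/
def Instance.Next (I : Instance) (X : Set ℕ) (i : ℕ) : Prop :=
  (I.HasAug X (fun _ => True) ∧ ((i ∈ X ∧ i ∈ I.removed X) ∨ (i ∉ X ∧ i ∉ I.removed X))) ∨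
    (¬ I.HasAug X (fun _ => True) ∧ i ∈ X)

/-- The common independent set that the algorithm finds. -/
def Instance.maxCommon (I : Instance) : Set ℕ :=
  -- On admissible instances each effective round adds one element, and a common independent set has
  -- at most `I.size` elements.
  stage (fun X _ i => I.Next X i) I.size I.size

/-- The answer of the algorithm. -/
def Instance.Accepts (I : Instance) : Prop :=
  -- Connectivity is tested in place of the size k - 1. The empty graph is rejected, having no
  -- spanning tree.
  0 < I.n ∧ ∀ v < I.n, I.Conn (fun i => ¬ I.IsDependent i ∨ i ∈ I.maxCommon) 0 v

end Algorithm

/-! ### The running time of the algorithm -/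

section RunningTime

variable {Γ Δ : Type} {R : Rep Γ} {R' : Rep Δ} {g : Δ → Γ} {ins : Γ → Instance}
  {A B : Γ → ℕ → Prop} {X Z : Γ → Set ℕ} {x y : Γ → ℕ} {φ : Γ → Prop}

/-- The representation `R'` contains the representation `R` of `g δ`. -/
structure Extends (R' : Rep Δ) (R : Rep Γ) (g : Δ → Γ) : Prop where
  rel : ∀ δ s, R'.rel δ s → R.rel (g δ) s
  d_le : R.d ≤ R'.d
  a_le : R.a ≤ R'.a
  N_eq : ∀ δ, R'.N δ = R.N (g δ)

theorem Extends.refl (R : Rep Γ) : Extends R R fun γ => γ :=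
  ⟨fun _ _ h => h, le_rfl, le_rfl, fun _ => rfl⟩

theorem Extends.ext (h : Extends R' R g) (k : ℕ) : Extends (R'.ext k) R fun p => g p.1 :=
  ⟨fun _ _ hs => h.rel _ _ hs.1, h.d_le.trans (by simp only [Rep.ext]; omega), h.a_le,
    fun _ => h.N_eq _⟩

theorem Extends.extSet (h : Extends R' R g) (l : ℕ) : Extends (R'.extSet l) R fun p => g p.1 :=
  ⟨fun _ _ hs => h.rel _ _ hs.1, h.d_le, h.a_le.trans (by simp only [Rep.extSet]; omega),
    fun _ => h.N_eq _⟩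

theorem Extends.polyFun (h : Extends R' R g) (hx : PolyFun R x) : PolyFun R' fun δ => x (g δ) :=
  hx.weaken g h.rel h.d_le h.a_le h.N_eq

theorem Extends.arr (h : Extends R' R g) {F : Γ → ℕ → ℕ} (hF : Arr R F) :
    Arr R' fun δ => F (g δ) := by
  obtain ⟨j, hj, H⟩ := hF
  exact ⟨j, hj.trans_le h.a_le, fun p s hs => H _ s (h.rel _ _ hs)⟩

theorem Extends.setVar (h : Extends R' R g) (hX : SetVar R X) : SetVar R' fun δ => X (g δ) := by
  obtain ⟨j, hj, H⟩ := hX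
  exact ⟨j, hj.trans_le h.a_le, fun p s hs => by rw [h.N_eq]; exact H _ s (h.rel _ _ hs)⟩

/-- The predicate `A` of numbers is decidable in polynomial time in all extensions of `R`. -/
def PolyPred (R : Rep Γ) (A : Γ → ℕ → Prop) : Prop :=
  -- Extensions are needed because `A` is evaluated inside loops and comprehensions, which store
  -- further counters and sets.
  ∀ ⦃Δ : Type⦄ ⦃R' : Rep Δ⦄ ⦃g : Δ → Γ⦄, Extends R' R g → ∀ ⦃x : Δ → ℕ⦄, PolyFun R' x →
    PolyDec R' fun δ => A (g δ) (x δ)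

theorem Extends.trans {Θ : Type} {R'' : Rep Θ} {g' : Θ → Δ} (h : Extends R' R g)
    (h' : Extends R'' R' g') : Extends R'' R fun θ => g (g' θ) :=
  ⟨fun _ _ hs => h.rel _ _ (h'.rel _ _ hs), h.d_le.trans h'.d_le, h.a_le.trans h'.a_le,
    fun _ => (h'.N_eq _).trans (h.N_eq _)⟩

theorem Extends.polyPred (h : Extends R' R g) (hA : PolyPred R A) :
    PolyPred R' fun δ => A (g δ) :=
  fun _ _ _ h' _ hx => hA (h.trans h') hx

theorem SetVar.polyPred (hX : SetVar R X) : PolyPred R fun γ i => i ∈ X γ :=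
  fun _ _ _ h _ hx => (h.setVar hX).polySet.mem hx

/-- The instance `ins γ` is part of the representation of `γ`, and its size is the bound. -/
structure View (R : Rep Γ) (ins : Γ → Instance) : Prop where
  bound : ∀ γ, R.N γ = (ins γ).size
  n : PolyFun R fun γ => (ins γ).n
  m : PolyFun R fun γ => (ins γ).m
  r : PolyFun R fun γ => (ins γ).r
  fst : Arr R fun γ => toArray (ins γ).fst
  snd : Arr R fun γ => toArray (ins γ).snd
  tail : Arr R fun γ => toArray (ins γ).tail
  head : Arr R fun γ => toArray (ins γ).head

namespace View

theorem of_extends (h : View R ins) (h' : Extends R' R g) : View R' fun δ => ins (g δ) :=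
  ⟨fun δ => (h'.N_eq δ).trans (h.bound _), h'.polyFun h.n, h'.polyFun h.m, h'.polyFun h.r,
    h'.arr h.fst, h'.arr h.snd, h'.arr h.tail, h'.arr h.head⟩

theorem n_le (h : View R ins) (γ : Γ) : (ins γ).n ≤ R.N γ := by
  rw [h.bound, Instance.size]; omega

theorem m_le (h : View R ins) (γ : Γ) : (ins γ).m ≤ R.N γ := by
  rw [h.bound, Instance.size]; omega

theorem r_le (h : View R ins) (γ : Γ) : (ins γ).r ≤ R.N γ := by
  rw [h.bound, Instance.size]; omega

theorem polyDec_isDependent (h : View R ins) (hx : PolyFun R x) :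
    PolyDec R fun γ => (ins γ).IsDependent (x γ) :=
  PolyDec.exists_lt_of_le h.r h.r_le fun k =>
    ((h.head.ext k).get (polyFun_snd k)).eq (hx.ext k)

theorem polyPred_isDependent (h : View R ins) : PolyPred R fun γ => (ins γ).IsDependent :=
  fun _ _ _ h' _ hx => (h.of_extends h').polyDec_isDependent hx

theorem polyDec_edgeAdj (h : View R ins) (hA : PolyPred R A) (hx : PolyFun R x)
    (hy : PolyFun R y) : PolyDec R fun γ => (ins γ).EdgeAdj (A γ) (x γ) (y γ) := by
  refine PolyDec.exists_lt_of_le h.m h.m_le fun k =>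
    (hA ((Extends.refl R).ext k) (polyFun_snd k)).and ?_
  have hf := (h.fst.ext k).get (polyFun_snd k)
  have hs := (h.snd.ext k).get (polyFun_snd k)
  exact ((hf.eq (hx.ext k)).and (hs.eq (hy.ext k))).or ((hf.eq (hy.ext k)).and (hs.eq (hx.ext k)))

theorem polyDec_conn (h : View R ins) (hA : PolyPred R A) (hx : PolyFun R x)
    (hy : PolyFun R y) : PolyDec R fun γ => (ins γ).Conn (A γ) (x γ) (y γ) := by
  refine (PolyDec.reach (φ := fun γ => (ins γ).EdgeAdj (A γ)) (fun l k k' k'' => ?_) hx hy).congr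
    fun γ => by rw [Instance.Conn, h.bound]
  have hE := ((((Extends.refl R).extSet l).ext k).ext k').ext k''
  exact polyDec_edgeAdj (h.of_extends hE) (hE.polyPred hA) (polyFun_snd k'')
    ((polyFun_snd k').ext k'')

theorem polyDec_depSpans (h : View R ins) (hA : PolyPred R A) (hy : PolyFun R y) :
    PolyDec R fun γ => (ins γ).DepSpans (A γ) (y γ) := by
  refine PolyDec.exists_lt_of_le h.r h.r_le fun k =>
    (((h.head.ext k).get (polyFun_snd k)).eq (hy.ext k)).and ?_
  have hE := (Extends.refl R).ext k
  have ht := (h.tail.ext k).get (polyFun_snd k)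
  refine polyDec_conn (h.of_extends hE) ?_ ((h.fst.ext k).get ht) ((h.snd.ext k).get ht)
  intro Δ R' g h' z hz
  refine PolyDec.exists_lt_of_le (φ := fun δ k => toArray (ins (g δ).1).tail k = z δ ∧
    A (g δ).1 (toArray (ins (g δ).1).head k)) (h.of_extends (hE.trans h')).r
    (h.of_extends (hE.trans h')).r_le fun k' => ?_
  have h'' := (hE.trans h').ext k'
  exact (((h.of_extends h'').tail.get (polyFun_snd k')).eq (hz.ext k')).and
    (hA h'' ((h.of_extends h'').head.get (polyFun_snd k')))

theorem polyDec_baseSpans (h : View R ins) (hA : PolyPred R A) (hy : PolyFun R y) :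
    PolyDec R fun γ => (ins γ).BaseSpans (A γ) (y γ) :=
  h.polyDec_conn (A := fun γ i => ¬ (ins γ).IsDependent i ∨ A γ i)
    (fun _ _ _ h' _ hx => (h.polyPred_isDependent h' hx).not.or (hA h' hx))
    (h.fst.get hy) (h.snd.get hy)

theorem polyPred_mem_ne (hX : PolyPred R fun γ i => i ∈ X γ) (hx : PolyFun R x) :
    PolyPred R fun γ i => i ∈ X γ ∧ i ≠ x γ :=
  fun _ _ _ h' _ hy => (hX h' hy).and (hy.eq (h'.polyFun hx)).not

theorem polyDec_arc (h : View R ins) (hX : PolyPred R fun γ i => i ∈ X γ) (hx : PolyFun R x)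
    (hy : PolyFun R y) : PolyDec R fun γ => (ins γ).Arc (X γ) (x γ) (y γ) := by
  have hm := fun z (hz : PolyFun R z) => hX (Extends.refl R) hz
  refine PolyDec.or ?_ ?_
  · exact ((h.polyDec_isDependent hx).and (hm x hx).not).and
      ((hm y hy).and (h.polyDec_baseSpans (polyPred_mem_ne hX hy) hx).not)
  · exact (hm x hx).and (((h.polyDec_isDependent hy).and (hm y hy).not).and
      (h.polyDec_depSpans (polyPred_mem_ne hX hx) hy).not)

theorem polyDec_hasAug (h : View R ins) (hX : PolyPred R fun γ i => i ∈ X γ) (hA : PolyPred R A) :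
    PolyDec R fun γ => (ins γ).HasAug (X γ) (A γ) := by
  refine (PolyDec.exists_lt (R := R) (φ := fun γ a => ∃ b < R.N γ, (A γ a ∧ A γ b) ∧
    (((ins γ).IsDependent a ∧ ¬ (ins γ).DepSpans (fun i => i ∈ X γ) a) ∧
      ((ins γ).IsDependent b ∧ ¬ (ins γ).BaseSpans (fun i => i ∈ X γ) b)) ∧
    Reach (R.N γ) (fun u v => (A γ u ∧ A γ v) ∧ (ins γ).Arc (X γ) u v) a b) fun k => ?_).congr
    fun γ => by rw [h.bound]; rfl
  refine PolyDec.exists_lt (R := R.ext k) (φ := fun p b => (A p.1 p.2 ∧ A p.1 b) ∧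
    (((ins p.1).IsDependent p.2 ∧ ¬ (ins p.1).DepSpans (fun i => i ∈ X p.1) p.2) ∧
      ((ins p.1).IsDependent b ∧ ¬ (ins p.1).BaseSpans (fun i => i ∈ X p.1) b)) ∧
    Reach (R.N p.1) (fun u v => (A p.1 u ∧ A p.1 v) ∧ (ins p.1).Arc (X p.1) u v) p.2 b)
    fun k' => ?_
  have hE := ((Extends.refl R).ext k).ext k'
  have hV := h.of_extends hE
  have ha := (polyFun_snd (R := R) k).ext k'
  have hb := polyFun_snd (R := R.ext k) k'
  have hX' := hE.polyPred hX
  have hA' := hE.polyPred hA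
  refine ((hA hE ha).and (hA hE hb)).and ((((hV.polyDec_isDependent ha).and
    (hV.polyDec_depSpans hX' ha).not).and ((hV.polyDec_isDependent hb).and
    (hV.polyDec_baseSpans hX' hb).not)).and ?_)
  refine PolyDec.reach (R := (R.ext k).ext k') (φ := fun p u v =>
    (A p.1.1 u ∧ A p.1.1 v) ∧ (ins p.1.1).Arc (X p.1.1) u v) (fun l j j' j'' => ?_) ha hb
  have hE' := (((hE.extSet l).ext j).ext j').ext j''
  have hu := polyFun_snd (R := ((((R.ext k).ext k').extSet l).ext j).ext j') j''
  have hv := (polyFun_snd (R := (((R.ext k).ext k').extSet l).ext j) j').ext j''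
  exact ((hA hE' hu).and (hA hE' hv)).and
    ((h.of_extends hE').polyDec_arc (hE'.polyPred hX) hu hv)

theorem polyPred_removed (h : View R ins) (hX : PolyPred R fun γ i => i ∈ X γ) :
    PolyPred R fun γ i => i ∈ (ins γ).removed (X γ) := by
  intro Δ R' g h' x hx
  refine (PolySet.mem (polySet_stage (R := R') (φ := fun δ Z t i => i ∈ Z ∨
    (i = t ∧ (ins (g δ)).HasAug (X (g δ)) fun j => j ∉ Z ∧ j ≠ t)) fun l k k' => ?_) hx).congr
    fun δ => by rw [(h.of_extends h').bound]; rfl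
  have hE := ((h'.extSet l).ext k).ext k'
  have hZ := (((setVar_snd (R := R') l).ext k).ext k').polyPred
  have hi := polyFun_snd (R := ((R'.extSet l).ext k)) k'
  have ht := (polyFun_snd (R := R'.extSet l) k).ext k'
  refine (hZ (Extends.refl _) hi).or ((hi.eq ht).and ?_)
  refine (h.of_extends hE).polyDec_hasAug (hE.polyPred hX) ?_
  intro Δ' R'' g' h'' y hy
  exact (hZ h'' hy).not.and (hy.eq (h''.polyFun ht)).not

theorem polyPred_maxCommon (h : View R ins) : PolyPred R fun γ i => i ∈ (ins γ).maxCommon := by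
  intro Δ R' g h' x hx
  refine (PolySet.mem (polySet_stage (R := R') (φ := fun δ X _ i => (ins (g δ)).Next X i)
    fun l k k' => ?_) hx).congr fun δ => by rw [(h.of_extends h').bound]; rfl
  have hE := ((h'.extSet l).ext k).ext k'
  have hV := h.of_extends hE
  have hX := (((setVar_snd (R := R') l).ext k).ext k').polyPred
  have hi := polyFun_snd (R := ((R'.extSet l).ext k)) k'
  have hm := hX (Extends.refl _) hi
  have hr := hV.polyPred_removed hX (Extends.refl _) hi
  have ha := hV.polyDec_hasAug (A := fun _ _ => True) hX fun _ R'' _ _ _ _ =>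
    ((polyFun_const (R := R'') 0).eq (polyFun_const 0)).congr fun _ => by simp
  exact (ha.and ((hm.and hr).or (hm.not.and hr.not))).or (ha.not.and hm)

theorem polyDec_accepts (h : View R ins) : PolyDec R fun γ => (ins γ).Accepts := by
  refine ((polyFun_const 0).lt h.n).and (PolyDec.forall_lt_of_le h.n h.n_le fun k => ?_)
  have hE := (Extends.refl R).ext k
  refine (h.of_extends hE).polyDec_conn ?_ (polyFun_const 0) (polyFun_snd k)
  intro Δ R' g h' x hx
  exact ((h.of_extends (hE.trans h')).polyDec_isDependent hx).not.or
    (h.polyPred_maxCommon (hE.trans h') hx)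

end View

/-- The machine holds an instance and its size. -/
def instanceRep : Rep Instance where
  rel I s := (s.reg 0 = I.n ∧ s.reg 1 = I.m ∧ s.reg 2 = I.r ∧ s.reg 3 = I.size) ∧
    s.arr 0 = toArray I.fst ∧ s.arr 1 = toArray I.snd ∧ s.arr 2 = toArray I.tail ∧
    s.arr 3 = toArray I.head
  d := 4
  a := 4
  N I := I.size
  nreg := 3
  nreg_lt := by omega
  reg_nreg I s h := h.1.2.2.2
  congr I s s' h h' := by
    rw [h.1 0 (by omega), h.1 1 (by omega), h.1 2 (by omega), h.1 3 (by omega),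
      h.2 0 (by omega), h.2 1 (by omega), h.2 2 (by omega), h.2 3 (by omega)]
    exact h'

theorem view_instanceRep : View instanceRep fun I => I where
  bound _ := rfl
  n := polyFun_reg (x := 0) (by decide) fun _ _ h => h.1.1
  m := polyFun_reg (x := 1) (by decide) fun _ _ h => h.1.2.1
  r := polyFun_reg (x := 2) (by decide) fun _ _ h => h.1.2.2.1
  fst := ⟨0, by decide, fun _ _ h => h.2.1⟩
  snd := ⟨1, by decide, fun _ _ h => h.2.2.1⟩
  tail := ⟨2, by decide, fun _ _ h => h.2.2.2.1⟩
  head := ⟨3, by decide, fun _ _ h => h.2.2.2.2⟩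

theorem solvableInPolyTime_of_accepts {P : Instance → Prop} {yes : {I : Instance // P I} → Prop}
    (h : ∀ I, I.1.Accepts ↔ yes I) :
    SolvableInPolyTime (fun I : {I : Instance // P I} => I.1.input) (fun I => I.1.size) yes := by
  obtain ⟨f, hf, H⟩ := view_instanceRep.polyDec_accepts
  obtain ⟨p, b, hp⟩ := hf 4 le_rfl 4 le_rfl
  -- The first two additions put the size n + m + r into register 3; the last two instructions copy
  -- the answer from register 4 to register 0.
  refine ⟨.seq (.add 3 0 1) (.seq (.add 3 3 2) (.seq p (.seq (.const 0 0) (.add 0 0 4)))), b + 4,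
    fun I => ?_⟩
  have hrun : Runs (.seq (.add 3 0 1) (.seq (.add 3 3 2) (.seq p (.seq (.const 0 0)
      (.add 0 0 4))))) I.1.input (1 + (1 + (b.eval I.1.size + (1 + 1))))
      fun s => s.reg 0 = f I.1 := by
    refine Runs.seq (Runs.add rfl) ?_
    rintro _ rfl
    refine Runs.seq (Runs.add rfl) ?_
    rintro _ rfl
    refine Runs.seq (hp I.1 _ ⟨⟨rfl, rfl, rfl, rfl⟩, rfl, rfl, rfl, rfl⟩) fun s hs => ?_
    refine Runs.seq (Runs.const rfl) ?_
    rintro _ rfl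
    refine Runs.add ?_
    simp [hs.2]
  obtain ⟨s, t, he, ht, hs⟩ := hrun
  refine ⟨s, t, he, ht.trans (by simp; omega), ?_⟩
  rw [hs, H]
  exact h I

end RunningTime


/-! ### Correctness of the algorithm -/

section Correctness

open Set

theorem toArray_of_lt {k b : ℕ} (f : Fin k → Fin b) {i : ℕ} (h : i < k) :
    toArray f i = f ⟨i, h⟩ := dif_pos h

@[simp] theorem toArray_val {k b : ℕ} (f : Fin k → Fin b) (i : Fin k) : toArray f i = f i :=
  toArray_of_lt f i.2

theorem exists_lt_toArray_iff {k b c : ℕ} {f : Fin k → Fin b} {g : Fin k → Fin c}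
    {P : ℕ → ℕ → Prop} :
    (∃ i < k, P (toArray f i) (toArray g i)) ↔ ∃ i, P (f i) (g i) := by
  constructor
  · rintro ⟨i, hi, h⟩
    rw [toArray_of_lt f hi, toArray_of_lt g hi] at h
    exact ⟨⟨i, hi⟩, h⟩
  · rintro ⟨i, h⟩
    exact ⟨i, i.2, by simpa using h⟩

namespace Instance

variable (I : Instance)

/-- The position of an edge in the list of edges. -/
def pos : I.G.edgeSet ↪ ℕ := I.edge.symm.toEmbedding.trans Fin.valEmbedding

theorem pos_edge (i : Fin I.m) : I.pos (I.edge i) = i := by simp [pos]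

theorem pos_lt (e : I.G.edgeSet) : I.pos e < I.m := (I.edge.symm e).2

theorem exists_pos_eq {i : ℕ} (hi : i < I.m) : ∃ e, I.pos e = i :=
  ⟨I.edge ⟨i, hi⟩, I.pos_edge _⟩

theorem edge_ends (e : I.G.edgeSet) : ∃ u v : Fin I.n, (e : Sym2 (Fin I.n)) = s(u, v) ∧
    toArray I.fst (I.pos e) = u ∧ toArray I.snd (I.pos e) = v := by
  obtain ⟨i, rfl⟩ := I.edge.surjective e
  exact ⟨_, _, I.edge_eq i, by rw [pos_edge, toArray_val], by rw [pos_edge, toArray_val]⟩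

theorem mem_dep_iff {e f : I.G.edgeSet} : f ∈ dep I.D e ↔
    ∃ k < I.r, toArray I.tail k = I.pos f ∧ toArray I.head k = I.pos e := by
  obtain ⟨i, rfl⟩ := I.edge.surjective e
  obtain ⟨j, rfl⟩ := I.edge.surjective f
  rw [exists_lt_toArray_iff (P := fun a b => a = I.pos (I.edge j) ∧ b = I.pos (I.edge i))]
  simp only [pos_edge, ← Fin.ext_iff]
  exact I.adj_iff j i

theorem exists_pos_arc {k : ℕ} (hk : k < I.r) : ∃ e f, toArray I.tail k = I.pos f ∧
    toArray I.head k = I.pos e ∧ f ∈ dep I.D e := by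
  obtain ⟨f, hf⟩ := I.exists_pos_eq (I.tail ⟨k, hk⟩).2
  obtain ⟨e, he⟩ := I.exists_pos_eq (I.head ⟨k, hk⟩).2
  rw [← toArray_of_lt] at hf he
  exact ⟨e, f, hf.symm, he.symm, I.mem_dep_iff.2 ⟨k, hk, hf.symm, he.symm⟩⟩

theorem isDependent_pos {e : I.G.edgeSet} :
    I.IsDependent (I.pos e) ↔ e ∈ dependentEdges I.D := by
  constructor
  · rintro ⟨k, hk, h⟩
    obtain ⟨e', f, -, he', hf⟩ := I.exists_pos_arc hk
    rw [he'] at h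
    obtain rfl := I.pos.injective h
    exact ⟨f, hf⟩
  · rintro ⟨f, hf⟩
    obtain ⟨k, hk, -, h⟩ := I.mem_dep_iff.1 hf
    exact ⟨k, hk, h⟩

theorem isDependent_iff {i : ℕ} : I.IsDependent i ↔ i ∈ I.pos '' dependentEdges I.D := by
  constructor
  · rintro ⟨k, hk, rfl⟩
    obtain ⟨e, f, -, he, hf⟩ := I.exists_pos_arc hk
    exact ⟨e, ⟨f, hf⟩, he.symm⟩
  · rintro ⟨e, he, rfl⟩
    exact I.isDependent_pos.2 he

theorem lt_size {i : ℕ} (h : I.IsDependent i) : i < I.size := by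
  obtain ⟨e, -, rfl⟩ := I.isDependent_iff.1 h
  have := I.pos_lt e
  rw [size]
  omega

theorem conn_iff {A : ℕ → Prop} {u v : Fin I.n} : I.Conn A u v ↔
    (SimpleGraph.fromEdgeSet (Subtype.val '' {e | A (I.pos e)})).Reachable u v := by
  -- The search ranges over numbers below `I.size` rather than `n`; the surplus numbers are ends of
  -- no edge and hence isolated.
  have hsize : ∀ u : Fin I.n, (u : ℕ) < I.size := fun u => by
    have := u.2
    rw [size]
    omega
  rw [SimpleGraph.reachable_fromEdgeSet_eq_reflTransGen_toRel]
  constructor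
  · rintro ⟨-, h⟩
    generalize hw : (v : ℕ) = w at h
    induction h generalizing v with
    | refl => rw [Fin.ext hw]
    | tail _ h ih =>
      obtain ⟨i, hi, hA, h⟩ := h.2.2
      obtain ⟨e, rfl⟩ := I.exists_pos_eq hi
      obtain ⟨a, b, he, ha, hb⟩ := I.edge_ends e
      rw [ha, hb] at h
      rcases h with ⟨h1, h2⟩ | ⟨h1, h2⟩
      · obtain rfl := Fin.ext (hw.trans h2.symm)
        exact (ih h1).tail ⟨e, hA, he⟩
      · obtain rfl := Fin.ext (hw.trans h1.symm)
        exact (ih h2).tail ⟨e, hA, he.trans Sym2.eq_swap⟩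
  · intro h
    refine ⟨hsize u, ?_⟩
    induction h with
    | refl => exact .refl
    | tail _ h ih =>
      obtain ⟨e, hA, he⟩ := h
      refine ih.tail ⟨hsize _, hsize _, I.pos e, I.pos_lt e, hA, ?_⟩
      obtain ⟨a, b, he', ha, hb⟩ := I.edge_ends e
      rw [ha, hb, Fin.val_inj, Fin.val_inj, Fin.val_inj, Fin.val_inj]
      exact Sym2.eq_iff.1 (he'.symm.trans he)

theorem conn_base_iff {A : ℕ → Prop} {u v : Fin I.n} :
    I.Conn (fun i => ¬ I.IsDependent i ∨ A i) u v ↔ (baseGraph I.D ⊔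
      SimpleGraph.fromEdgeSet (Subtype.val '' {e | A (I.pos e)})).Reachable u v := by
  rw [conn_iff]
  have hgraph : SimpleGraph.fromEdgeSet (Subtype.val ''
      {e | ¬ I.IsDependent (I.pos e) ∨ A (I.pos e)}) = baseGraph I.D ⊔
      SimpleGraph.fromEdgeSet (Subtype.val '' {e | A (I.pos e)}) := by
    ext x y
    rw [SimpleGraph.sup_adj, SimpleGraph.fromEdgeSet_adj, SimpleGraph.fromEdgeSet_adj,
      baseGraph_adj]
    constructor
    · rintro ⟨⟨e, h | h, he⟩, hne⟩
      · left
        have hG : I.G.Adj x y := by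
          rw [← SimpleGraph.mem_edgeSet, ← he]
          exact e.2
        rw [isDependent_pos, show e = ⟨s(x, y), hG⟩ from Subtype.ext he] at h
        exact ⟨hG, h⟩
      · exact .inr ⟨⟨e, h, he⟩, hne⟩
    · rintro (⟨hG, h⟩ | ⟨⟨e, h, he⟩, hne⟩)
      · exact ⟨⟨⟨s(x, y), hG⟩, .inl (by rwa [isDependent_pos]), rfl⟩, hG.ne⟩
      · exact ⟨⟨e, .inr h, he⟩, hne⟩
  rw [hgraph]

theorem baseSpans_iff {A : ℕ → Prop} {e : I.G.edgeSet} {x y : Fin I.n}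
    (he : (e : Sym2 (Fin I.n)) = s(x, y)) : I.BaseSpans A (I.pos e) ↔ (baseGraph I.D ⊔
      SimpleGraph.fromEdgeSet (Subtype.val '' {e | A (I.pos e)})).Reachable x y := by
  obtain ⟨a, b, he', ha, hb⟩ := I.edge_ends e
  rw [BaseSpans, ha, hb, conn_base_iff]
  rcases Sym2.eq_iff.1 (he'.symm.trans he) with ⟨rfl, rfl⟩ | ⟨rfl, rfl⟩
  · rfl
  · exact SimpleGraph.reachable_comm

theorem depSpans_iff (hD : ComponentsArePathsOfLengthLEOne I.D) {A : ℕ → Prop}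
    {e f : I.G.edgeSet} (hf : f ∈ dep I.D e) {x y : Fin I.n}
    (hxy : (f : Sym2 (Fin I.n)) = s(x, y)) : I.DepSpans A (I.pos e) ↔
      (SimpleGraph.fromEdgeSet
        (Subtype.val '' depSet I.D {e | A (I.pos e)})).Reachable x y := by
  have hset : {f | ∃ k < I.r, toArray I.tail k = I.pos f ∧ A (toArray I.head k)} =
      depSet I.D {e | A (I.pos e)} := by
    ext g
    simp only [depSet, mem_iUnion, mem_ofPred_eq]
    constructor
    · rintro ⟨k, hk, hg, hA⟩
      obtain ⟨e', f', hf', he', h⟩ := I.exists_pos_arc hk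
      rw [hf'] at hg
      obtain rfl := I.pos.injective hg
      exact ⟨e', he' ▸ hA, h⟩
    · rintro ⟨e', hA, h⟩
      obtain ⟨k, hk, h1, h2⟩ := I.mem_dep_iff.1 h
      exact ⟨k, hk, h1, h2 ▸ hA⟩
  have key : I.Conn (fun i => ∃ k < I.r, toArray I.tail k = i ∧ A (toArray I.head k))
      (toArray I.fst (I.pos f)) (toArray I.snd (I.pos f)) ↔ (SimpleGraph.fromEdgeSet
        (Subtype.val '' depSet I.D {e | A (I.pos e)})).Reachable x y := by
    obtain ⟨a, b, hf', ha, hb⟩ := I.edge_ends f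
    rw [ha, hb, conn_iff, hset]
    rcases Sym2.eq_iff.1 (hf'.symm.trans hxy) with ⟨rfl, rfl⟩ | ⟨rfl, rfl⟩
    · rfl
    · exact SimpleGraph.reachable_comm
  rw [← key]
  constructor
  · rintro ⟨k, hk, h1, h2⟩
    obtain ⟨e', f', hf', he', h⟩ := I.exists_pos_arc hk
    rw [he'] at h1
    obtain rfl := I.pos.injective h1
    rw [hf', (hD.eq_of_adj hf h (by simp)).1] at h2
    exact h2
  · intro h
    obtain ⟨k, hk, h1, h2⟩ := I.mem_dep_iff.1 hf
    exact ⟨k, hk, h2, by rwa [h1]⟩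

/-- The first matroid, on the positions of the edges. -/
noncomputable def depMatroid : Matroid ℕ := (DCST.depMatroid I.D).mapEmbedding I.pos

/-- The second matroid, on the positions of the edges. -/
noncomputable def contractedMatroid : Matroid ℕ :=
  (DCST.contractedMatroid I.D).mapEmbedding I.pos

theorem mem_depMatroid_ground {i : ℕ} : i ∈ I.depMatroid.E ↔ I.IsDependent i :=
  I.isDependent_iff.symm

theorem mem_contractedMatroid_ground {i : ℕ} : i ∈ I.contractedMatroid.E ↔ I.IsDependent i :=
  I.isDependent_iff.symm

theorem ground_eq : I.depMatroid.E = I.contractedMatroid.E := rfl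

variable {I} {X : Set ℕ}

theorem indep_preimage₁ (hX : I.depMatroid.Indep X) :
    (DCST.depMatroid I.D).Indep (I.pos ⁻¹' X) := (Matroid.mapEmbedding_indep_iff.1 hX).1

theorem indep_preimage₂ (hX : I.contractedMatroid.Indep X) :
    (DCST.contractedMatroid I.D).Indep (I.pos ⁻¹' X) := (Matroid.mapEmbedding_indep_iff.1 hX).1

/-- Justifies the first connectivity test of the algorithm as a closure oracle;
`mem_closure_contractedMatroid` does so for the second. -/
theorem mem_closure_depMatroid (hD : ComponentsArePathsOfLengthLEOne I.D)
    (hX : I.depMatroid.Indep X) {y : ℕ} (hy : I.IsDependent y) :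
    y ∈ I.depMatroid.closure X ↔ I.DepSpans (fun i => i ∈ X) y := by
  obtain ⟨e, he, rfl⟩ := I.isDependent_iff.1 hy
  obtain ⟨f, hf⟩ := he
  induction hxy : (f : Sym2 (Fin I.n)) with
  | h x y =>
    rw [I.depSpans_iff hD hf hxy, depMatroid, Matroid.mapEmbedding, Matroid.map_closure_eq,
      I.pos.injective.mem_set_image]
    have hX' := indep_preimage₁ hX
    rw [DCST.depMatroid, mem_closure_graphicMatroid _ hX' ⟨f, hf⟩ ((depEnds_eq hD hf).trans hxy),
      image_depEnds hD hX'.1]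
    rfl

theorem mem_closure_contractedMatroid
    (hX : I.contractedMatroid.Indep X) {y : ℕ} (hy : I.IsDependent y) :
    y ∈ I.contractedMatroid.closure X ↔ I.BaseSpans (fun i => i ∈ X) y := by
  obtain ⟨e, he, rfl⟩ := I.isDependent_iff.1 hy
  induction hxy : (e : Sym2 (Fin I.n)) with
  | h x y =>
    rw [I.baseSpans_iff hxy, contractedMatroid, Matroid.mapEmbedding, Matroid.map_closure_eq,
      I.pos.injective.mem_set_image]
    have hX' := indep_preimage₂ hX
    rw [DCST.contractedMatroid, mem_closure_graphicMatroid _ hX' he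
      (show contractedEnds I.D e = s(_, _) by rw [contractedEnds, hxy]; rfl),
      reachable_contractedEnds_iff]
    rfl

theorem arc_iff (hD : ComponentsArePathsOfLengthLEOne I.D) (h₁ : I.depMatroid.Indep X)
    (h₂ : I.contractedMatroid.Indep X) {u v : ℕ} :
    I.Arc X u v ↔ ExchangeArc I.depMatroid I.contractedMatroid X u v := by
  have hu : I.IsDependent u → (¬ I.BaseSpans (fun i => i ∈ X ∧ i ≠ v) u ↔
      u ∉ I.contractedMatroid.closure (X \ {v})) := fun hu =>
    not_congr (mem_closure_contractedMatroid (h₂.subset sdiff_subset) hu).symm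
  have hv : I.IsDependent v → (¬ I.DepSpans (fun i => i ∈ X ∧ i ≠ u) v ↔
      v ∉ I.depMatroid.closure (X \ {u})) := fun hv =>
    not_congr (mem_closure_depMatroid hD (h₁.subset sdiff_subset) hv).symm
  rw [Arc, ExchangeArc, mem_sdiff, mem_sdiff, mem_contractedMatroid_ground, mem_depMatroid_ground]
  tauto

theorem hasAug_iff (hD : ComponentsArePathsOfLengthLEOne I.D) (h₁ : I.depMatroid.Indep X)
    (h₂ : I.contractedMatroid.Indep X) {W : ℕ → Prop} : I.HasAug X W ↔
      HasAugmentingPath I.depMatroid I.contractedMatroid X {i | i < I.size ∧ W i} := by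
  have hrel : (fun u v => u < I.size ∧ v < I.size ∧ (W u ∧ W v) ∧ I.Arc X u v) =
      fun u v => u ∈ {i | i < I.size ∧ W i} ∧ v ∈ {i | i < I.size ∧ W i} ∧
        ExchangeArc I.depMatroid I.contractedMatroid X u v := by
    funext u v
    rw [arc_iff hD h₁ h₂, mem_ofPred_eq, mem_ofPred_eq]
    exact propext (by tauto)
  have hs : ∀ a, (I.IsDependent a ∧ ¬ I.DepSpans (fun i => i ∈ X) a) ↔
      a ∈ I.depMatroid.E \ I.depMatroid.closure X := fun a => by
    rw [mem_sdiff, mem_depMatroid_ground]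
    exact and_congr_right fun h => not_congr (mem_closure_depMatroid hD h₁ h).symm
  have ht : ∀ b, (I.IsDependent b ∧ ¬ I.BaseSpans (fun i => i ∈ X) b) ↔
      b ∈ I.contractedMatroid.E \ I.contractedMatroid.closure X := fun b => by
    rw [mem_sdiff, mem_contractedMatroid_ground]
    exact and_congr_right fun h => not_congr (mem_closure_contractedMatroid h₂ h).symm
  simp only [HasAug, Reach, hrel, hs, ht]
  constructor
  · rintro ⟨a, ha, b, hb, ⟨hWa, hWb⟩, ⟨h1, h2⟩, -, h⟩
    exact ⟨a, ⟨ha, hWa⟩, b, ⟨hb, hWb⟩, h1, h2, h⟩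
  · rintro ⟨a, ⟨ha, hWa⟩, b, ⟨hb, hWb⟩, h1, h2, h⟩
    exact ⟨a, ha, b, hb, ⟨hWa, hWb⟩, ⟨h1, h2⟩, ha, h⟩

/-- All vertices of an augmenting path are positions of edges, so the bound `I.size` loses nothing.
-/
theorem hasAug_true_iff (hD : ComponentsArePathsOfLengthLEOne I.D) (h₁ : I.depMatroid.Indep X)
    (h₂ : I.contractedMatroid.Indep X) : I.HasAug X (fun _ => True) ↔
      HasAugmentingPath I.depMatroid I.contractedMatroid X univ := by
  rw [hasAug_iff hD h₁ h₂]
  refine ⟨fun h => h.mono (subset_univ _), ?_⟩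
  have hE : ∀ a ∈ I.depMatroid.E, a < I.size := fun a ha =>
    lt_size _ (I.mem_depMatroid_ground.1 ha)
  have hE' : ∀ a ∈ I.contractedMatroid.E, a < I.size := fun a ha =>
    lt_size _ (I.mem_contractedMatroid_ground.1 ha)
  have hX : ∀ a ∈ X, a < I.size := fun a ha => hE a (h₁.subset_ground ha)
  rintro ⟨a, -, b, -, ha, hb, h⟩
  refine ⟨a, ⟨hE a ha.1, trivial⟩, b, ⟨hE' b hb.1, trivial⟩, ha, hb,
    Relation.ReflTransGen.mono ?_ _ _ h⟩
  rintro u v ⟨-, -, huv⟩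
  rcases id huv with ⟨hu, hv, -⟩ | ⟨hu, hv, -⟩
  · exact ⟨⟨hE' u hu.1, trivial⟩, ⟨hX v hv, trivial⟩, huv⟩
  · exact ⟨⟨hX u hu, trivial⟩, ⟨hE v hv.1, trivial⟩, huv⟩

/-- The numbers left after the greedy removal form an inclusion-minimal set with an augmenting path,
as `indep_symmDiff` requires. -/
theorem setOf_next (hD : ComponentsArePathsOfLengthLEOne I.D) (h₁ : I.depMatroid.Indep X)
    (h₂ : I.contractedMatroid.Indep X) : I.depMatroid.Indep {i | i < I.size ∧ I.Next X i} ∧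
      I.contractedMatroid.Indep {i | i < I.size ∧ I.Next X i} ∧
      (HasAugmentingPath I.depMatroid I.contractedMatroid X univ →
        {i | i < I.size ∧ I.Next X i}.encard = X.encard + 1) ∧
      (¬ HasAugmentingPath I.depMatroid I.contractedMatroid X univ →
        {i | i < I.size ∧ I.Next X i} = X) := by
  have hX : ∀ a ∈ X, a < I.size := fun a ha =>
    lt_size _ (I.mem_depMatroid_ground.1 (h₁.subset_ground ha))
  rw [← hasAug_true_iff hD h₁ h₂]
  by_cases haug : I.HasAug X fun _ => True
  · set φ : Set ℕ → ℕ → ℕ → Prop :=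
      fun Z t i => i ∈ Z ∨ (i = t ∧ I.HasAug X fun j => j ∉ Z ∧ j ≠ t)
    have hmem : ∀ t i, i ∈ stage φ I.size (t + 1) ↔ i < I.size ∧
      (i ∈ stage φ I.size t ∨ (i = t ∧ I.HasAug X fun j => j ∉ stage φ I.size t ∧ j ≠ t)) :=
      fun _ _ => Iff.rfl
    have hmono : Monotone (stage φ I.size) := monotone_nat_of_le_succ fun t i hi =>
      (hmem t i).2 ⟨stage_subset φ _ _ hi, .inl hi⟩
    -- A path among the remaining numbers survives every round.
    have hinv : ∀ t, I.HasAug X fun j => j ∉ stage φ I.size t := by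
      intro t
      induction t with
      | zero => simpa [stage] using haug
      | succ t ih =>
        rw [hasAug_iff hD h₁ h₂] at ih ⊢
        by_cases h : I.HasAug X fun j => j ∉ stage φ I.size t ∧ j ≠ t
        · rw [hasAug_iff hD h₁ h₂] at h
          refine h.mono fun j hj => ⟨hj.1, fun hj' => ?_⟩
          rcases ((hmem t j).1 hj').2 with h' | h'
          · exact hj.2.1 h'
          · exact hj.2.2 h'.1
        · refine ih.mono fun j hj => ⟨hj.1, fun hj' => ?_⟩
          rcases ((hmem t j).1 hj').2 with h' | h'
          · exact hj.2 h'
          · exact h h'.2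
    have hW := (hasAug_iff hD h₁ h₂).1 (hinv I.size)
    have hnext : {i | i < I.size ∧ I.Next X i} =
        symmDiff X {i | i < I.size ∧ i ∉ stage φ I.size I.size} := by
      ext i
      have := hX i
      simp only [Next, haug, removed, mem_symmDiff, mem_ofPred_eq]
      tauto
    -- If some `w` were still dispensable at the end, it would have been dispensable in round `w`,
    -- when more numbers remained, and would have been removed.
    obtain ⟨h1, h2, h3⟩ := indep_symmDiff I.ground_eq h₁ h₂ hW fun w hw h => hw.2 <|
      hmono (show w + 1 ≤ I.size from hw.1) <| (hmem w w).2 ⟨hw.1, .inr ⟨rfl, by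
        rw [hasAug_iff hD h₁ h₂]
        exact h.mono fun j hj => ⟨hj.1.1, fun hj' => hj.1.2 (hmono hw.1.le hj'), hj.2⟩⟩⟩
    rw [hnext]
    exact ⟨h1, h2, fun _ => h3, fun h => absurd haug h⟩
  · have hnext : {i | i < I.size ∧ I.Next X i} = X := by
      ext i
      have := hX i
      simp only [Next, haug, mem_ofPred_eq]
      tauto
    rw [hnext]
    exact ⟨h₁, h₂, fun h => absurd h haug, fun _ => rfl⟩

theorem maxCommon_spec (I : Instance) (hD : ComponentsArePathsOfLengthLEOne I.D) :
    I.depMatroid.Indep I.maxCommon ∧ I.contractedMatroid.Indep I.maxCommon ∧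
      ∀ J, I.depMatroid.Indep J → I.contractedMatroid.Indep J →
        J.encard ≤ I.maxCommon.encard := by
  have key : ∀ t : ℕ, I.depMatroid.Indep (stage (fun X _ i => I.Next X i) I.size t) ∧
      I.contractedMatroid.Indep (stage (fun X _ i => I.Next X i) I.size t) ∧
      ((stage (fun X _ i => I.Next X i) I.size t).encard = t ∨
        ¬ HasAugmentingPath I.depMatroid I.contractedMatroid
          (stage (fun X _ i => I.Next X i) I.size t) univ) := by
    intro t
    induction t with
    | zero => simp [stage]
    | succ t ih =>
      obtain ⟨h₁, h₂, h⟩ := ih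
      obtain ⟨h1, h2, h3, h4⟩ := setOf_next hD h₁ h₂
      refine ⟨h1, h2, ?_⟩
      by_cases haug : HasAugmentingPath I.depMatroid I.contractedMatroid
          (stage (fun X _ i => I.Next X i) I.size t) univ
      · left
        rw [stage, h3 haug, h.resolve_right (not_not_intro haug)]
        push_cast
        rfl
      · right
        rwa [stage, h4 haug]
  obtain ⟨h₁, h₂, h⟩ := key I.size
  refine ⟨h₁, h₂, fun J hJ₁ hJ₂ => ?_⟩
  rcases h with h | h
  -- If every round succeeded, the set has `I.size` elements, and every common independent set
  -- consists of numbers below `I.size`.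
  · rw [maxCommon, h]
    have hJ : J ⊆ Iio I.size := fun j hj =>
      lt_size _ (I.mem_depMatroid_ground.1 (hJ₁.subset_ground hj))
    refine (encard_le_encard hJ).trans ?_
    rw [(finite_Iio _).encard_eq_coe_toFinset_card]
    simp
  · exact encard_le_of_not_hasAugmentingPath I.ground_eq h₁ h₂ h hJ₁ hJ₂

/-- A common independent set of size k - 1 exists iff a maximum one has that size, which for an
`M₂`-independent set means that it connects H. -/
theorem accepts_iff (I : Instance) (hD : ComponentsArePathsOfLengthLEOne I.D) : I.Accepts ↔
    GDCST I.D (fun e => (dep I.D e).ncard) (fun e => (dep I.D e).ncard) := by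
  obtain ⟨h₁, h₂, hmax⟩ := I.maxCommon_spec hD
  have hc : I.Accepts ↔ (SimpleGraph.fromEdgeSet
      (contractedEnds I.D '' (I.pos ⁻¹' I.maxCommon))).Connected := by
    rw [connected_contractedEnds_iff, SimpleGraph.connected_iff_exists_forall_reachable, Accepts]
    have hconn : ∀ u v : Fin I.n, I.Conn (fun i => ¬ I.IsDependent i ∨ i ∈ I.maxCommon) u v ↔
      (baseGraph I.D ⊔ SimpleGraph.fromEdgeSet
        (Subtype.val '' (I.pos ⁻¹' I.maxCommon))).Reachable u v := fun u v => I.conn_base_iff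
    constructor
    · rintro ⟨hn, h⟩
      exact ⟨⟨0, hn⟩, fun v => (hconn ⟨0, hn⟩ v).1 (h v v.2)⟩
    · rintro ⟨u, h⟩
      have hn : 0 < I.n := u.pos
      exact ⟨hn, fun v hv => (hconn ⟨0, hn⟩ ⟨v, hv⟩).2 ((h ⟨0, hn⟩).symm.trans (h ⟨v, hv⟩))⟩
  have hi₁ := indep_preimage₁ h₁
  have hi₂ := indep_preimage₂ h₂
  rw [hc, gdcst_iff_exists_indep hD fun e => ⟨rfl, rfl⟩]
  constructor
  · intro h
    exact ⟨_, hi₁, hi₂, (IsForest.connected_iff hi₂.2).1 h⟩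
  · rintro ⟨J, hJ₁, hJ₂, hJ⟩
    have hJc := (IsForest.connected_iff hJ₂.2).2 hJ
    rw [IsForest.connected_iff hi₂.2, ← hJ]
    -- `J` connects H and so spans the second matroid; no independent set is larger.
    have hle : (I.pos ⁻¹' I.maxCommon).encard ≤ J.encard := by
      refine encard_le_of_subset_closure hi₂ fun e he => ?_
      induction hx : contractedEnds I.D e with
      | h x y =>
        exact (mem_closure_graphicMatroid _ hJ₂ (hi₂.1 he) hx).2 (hJc.preconnected x y)
    have hge : J.encard ≤ (I.pos ⁻¹' I.maxCommon).encard := by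
      have hpre : I.pos ⁻¹' (I.pos '' J) = J := preimage_image_eq _ I.pos.injective
      have := hmax (I.pos '' J)
        (Matroid.mapEmbedding_indep_iff.2 ⟨by rwa [hpre], image_subset_range _ _⟩)
        (Matroid.mapEmbedding_indep_iff.2 ⟨by rwa [hpre], image_subset_range _ _⟩)
      rwa [I.pos.injective.encard_image, ← image_preimage_eq_of_subset
        (Matroid.mapEmbedding_indep_iff.1 h₁).2, I.pos.injective.encard_image] at this
    rw [ncard, ncard, hle.antisymm hge]

end Instance

end Correctness

end DCST

/-! ### Assembly of the algorithmic and the structural claim -/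

theorem mainTheorem7 :
    DCST.SolvableInPolyTime
      (ι := {I : DCST.Instance // DCST.ComponentsArePathsOfLengthLEOne I.D})
      (fun I => I.1.input) (fun I => I.1.size)
      (fun I => DCST.GDCST I.1.D
        (fun e => (DCST.dep I.1.D e).ncard) (fun e => (DCST.dep I.1.D e).ncard)) ∧
    ∀ (V : Type*) [Finite V] (G : SimpleGraph V) (D : Digraph G.edgeSet) (ℓ u : G.edgeSet → ℕ),
      DCST.ComponentsArePathsOfLengthLEOne D →
      (∀ e, ℓ e = u e ∧ u e = (DCST.dep D e).ncard) →
      ∃ M₁ M₂ : Matroid G.edgeSet,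
        M₁.E = DCST.dependentEdges D ∧
        (∀ X : Set G.edgeSet, M₁.Indep X ↔ X ⊆ DCST.dependentEdges D ∧
          (SimpleGraph.fromEdgeSet (Subtype.val '' DCST.depSet D X)).IsAcyclic) ∧
        (∃ ends : G.edgeSet → Sym2 V,
          (∀ e, ∀ f ∈ DCST.dep D e, ends e = f) ∧ DCST.IsGraphicMatroidOf M₁ ends) ∧
        M₂.E = DCST.dependentEdges D ∧
        DCST.IsGraphicMatroidOf M₂ (DCST.contractedEnds D) ∧
        (DCST.GDCST D ℓ u ↔
          ∃ X : Set G.edgeSet, M₁.Indep X ∧ M₂.Indep X ∧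
            X.ncard + 1 = Nat.card (DCST.baseGraph D).ConnectedComponent) := by
  refine ⟨DCST.solvableInPolyTime_of_accepts fun I => I.1.accepts_iff I.2, ?_⟩
  intro V _ G D ℓ u hD h
  refine ⟨DCST.depMatroid D, DCST.contractedMatroid D, rfl, fun X => ?_,
    ⟨DCST.depEnds D, fun e f hf => DCST.depEnds_eq hD hf, fun X => Iff.rfl⟩, rfl,
    fun X => Iff.rfl, DCST.gdcst_iff_exists_indep hD h⟩
  exact and_congr_right fun hX => DCST.isForest_depEnds_iff hD hX
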